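/- Conventions. A metric measure space $(X,d,\mathfrak m)$ is a complete separable metric space with a Radon (Borel, locally finite) measure $\mathfrak m\ge 0$; $L^0(\mathfrak m)$ is the ring of Borel functions $X\to\mathbb R$ modulo $\mathfrak m$-a.e. equality. A normed $L^0(\mathfrak m)$-module is an $L^0(\mathfrak m)$-module $\mathscr M$ with a pointwise norm $|\cdot|:\mathscr M\to L^0(\mathfrak m)$ (i.e. $|v|\ge 0$, $|v+w|\le|v|+|w|$, $|g\cdot v|=|g||v|$ $\mathfrak m$-a.e., and $|v|=0$ iff $v=0$) such that the distance $d_{\mathscr M}(v,w)=\int |v-w|\wedge 1\,d\mathfrak m'$ is complete, where $\mathfrak m'$ is a probability measure with $\mathfrak m\ll\mathfrak m'\ll\mathfrak m$ (if $\mathfrak m=0$, take $\mathfrak m'=0$). A morphism is an $L^0(\mathfrak m)$-linear map $\varphi$ with $|\varphi(v)|\le|v|$ $\mathfrak m$-a.e. for all $v$. Direct systems over a (nonempty) directed partially ordered set and direct limits are taken in the category of normed $L^0(\mathfrak m)$-modules; a direct limit is a target (an object with a compatible family of morphisms from the system) through which every target factors by a unique morphism. Let $(X,d_X,\mathfrak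 m_X)$, $(Y,d_Y,\mathfrak m_Y)$ be metric measure spaces and $f:X\to Y$ a Borel map with $f_*\mathfrak m_X\ll\mathfrak m_Y$. A pullback of a normed $L^0(\mathfrak m_Y)$-module $\mathscr M$ is a couple $(f^*\mathscr M,f^*)$ of a normed $L^0(\mathfrak m_X)$-module $f^*\mathscr M$ and a (real-)linear map $f^*:\mathscr M\to f^*\mathscr M$ such that $|f^*v|=|v|\circ f$ $\mathfrak m_X$-a.e. for every $v\in\mathscr M$ and such that the $L^0(\mathfrak m_X)$-span of $\{f^*v: v\in\mathscr M\}$ is dense in $f^*\mathscr M$. For a morphism $\varphi:\mathscr M\to\mathscr N$ of normed $L^0(\mathfrak m_Y)$-modules, $f^*\varphi:f^*\mathscr M\to f^*\mathscr N$ denotes the morphism with $f^*\varphi\circ f^*=f^*\circ\varphi$. Theorem (Pullback and direct limit commute). Let $(\{\mathscr M_i\}_{i\in I},\{\varphi_{ij}\}_{i\le j})$ be a direct system of normed $L^0(\mathfrak m_Y)$-modules. Then it has a direct limit, and every normed $L^0(\mathfrak m_Y)$-module has a pullback. Moreover, for every direct limit $(\varinjlim\mathscr M_\star,\{\varphi_i\}_{i\in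 I})$ of the system and every choice of pullbacks $f^*\mathscr M_i$ and $f^*\varinjlim\mathscr M_\star$, the morphisms $f^*\varphi_{ij}$ ($i\le j$) and $f^*\varphi_i$ ($i\in I$) exist and are unique, $(\{f^*\mathscr M_i\}_{i\in I},\{f^*\varphi_{ij}\}_{i\le j})$ is a direct system of normed $L^0(\mathfrak m_X)$-modules, and its direct limit is $f^*\varinjlim\mathscr M_\star$ together with the canonical morphisms $f^*\varphi_i$. -/

import Mathlib

open MeasureTheory Measure Filter Topology

universe uX uY v w

/-- `L0 μ` is the space of Borel real functions on `X` up to `μ`-a.e. equality. -/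
abbrev L0 {X : Type*} [MeasurableSpace X] (μ : Measure X) : Type _ := X →ₘ[μ] ℝ

/-- Pointwise a.e. operations make `L0 μ` a commutative ring (additive group and multiplicative
monoid structure are the ones of Mathlib). -/
noncomputable instance L0.instCommRing {X : Type*} [MeasurableSpace X] {μ : Measure X} :
    CommRing (X →ₘ[μ] ℝ) :=
  { (AEEqFun.instAddCommGroup : AddCommGroup (X →ₘ[μ] ℝ)),
    (AEEqFun.instCommMonoid : CommMonoid (X →ₘ[μ] ℝ)) with
    left_distrib := fun a b c => AEEqFun.toGerm_injective (by
      simp only [AEEqFun.mul_toGerm, AEEqFun.add_toGerm, mul_add])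
    right_distrib := fun a b c => AEEqFun.toGerm_injective (by
      simp only [AEEqFun.mul_toGerm, AEEqFun.add_toGerm, add_mul])
    zero_mul := fun a => AEEqFun.toGerm_injective (by
      simp only [AEEqFun.mul_toGerm, AEEqFun.zero_toGerm, zero_mul])
    mul_zero := fun a => AEEqFun.toGerm_injective (by
      simp only [AEEqFun.mul_toGerm, AEEqFun.zero_toGerm, mul_zero]) }

/-- The number `∫ |h| ∧ 1 dm'`, where `m'` is a Borel probability measure with `μ ≪ m' ≪ μ`
(here `m' = μ.toFinite`, which is the zero measure if `μ = 0`). -/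
noncomputable def L0.size {X : Type*} [MeasurableSpace X] {μ : Measure X} [SFinite μ]
    (h : L0 μ) : ℝ :=
  ∫ x, min |h x| 1 ∂μ.toFinite

/-- A normed `L⁰(μ)`-module: an `L⁰(μ)`-module with a pointwise norm `|·|`, complete with respect to
the distance `d(v, w) = ∫ |v - w| ∧ 1 dm'`. The order on `L0 μ` is the `μ`-a.e. order. -/
structure NormedL0Module {X : Type uX} [MeasurableSpace X] (μ : Measure X) [SFinite μ] :
    Type (max uX (v + 1)) where
  carrier : Type v
  [addCommGroup : AddCommGroup carrier]
  [module : Module (L0 μ) carrier]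
  ptNorm : carrier → L0 μ
  ptNorm_nonneg : ∀ a, 0 ≤ ptNorm a
  ptNorm_add_le : ∀ a b, ptNorm (a + b) ≤ ptNorm a + ptNorm b
  ptNorm_smul : ∀ (g : L0 μ) (a : carrier), ptNorm (g • a) = |g| * ptNorm a
  ptNorm_eq_zero_iff : ∀ a, ptNorm a = 0 ↔ a = 0
  /-- every Cauchy sequence converges -/
  complete : ∀ s : ℕ → carrier,
    (∀ ε : ℝ, 0 < ε → ∃ N, ∀ m ≥ N, ∀ n ≥ N, L0.size (ptNorm (s m - s n)) < ε) →
    ∃ a, Tendsto (fun n => L0.size (ptNorm (s n - a))) atTop (𝓝 0)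

namespace NormedL0Module

instance {X : Type uX} [MeasurableSpace X] {μ : Measure X} [SFinite μ] :
    CoeSort (NormedL0Module.{uX, v} μ) (Type v) := ⟨carrier⟩

attribute [instance] NormedL0Module.addCommGroup NormedL0Module.module

section

variable {X : Type uX} [MeasurableSpace X] {μ : Measure X} [SFinite μ]

/-- The distance `d(a, b) = ∫ |a - b| ∧ 1 dm'`. -/
noncomputable def ptDist (M : NormedL0Module.{uX, v} μ) (a b : M) : ℝ :=
  L0.size (M.ptNorm (a - b))

/-- `S` generates `M`: the submodule spanned by `S` is dense. -/
def Generates (M : NormedL0Module.{uX, v} μ) (S : Set M) : Prop :=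
  ∀ a : M, ∀ ε : ℝ, 0 < ε → ∃ b ∈ Submodule.span (L0 μ) S, M.ptDist a b < ε

/-- Morphisms of normed `L⁰(μ)`-modules: `L⁰(μ)`-linear maps `φ` with `|φ a| ≤ |a|` a.e. -/
structure Hom (M : NormedL0Module.{uX, v} μ) (N : NormedL0Module.{uX, w} μ) where
  toLinearMap : M →ₗ[L0 μ] N
  ptNorm_le : ∀ a, N.ptNorm (toLinearMap a) ≤ M.ptNorm a

noncomputable instance {M : NormedL0Module.{uX, v} μ} {N : NormedL0Module.{uX, w} μ} :
    CoeFun (Hom M N) (fun _ => M → N) := ⟨fun φ => φ.toLinearMap⟩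

/-- `(M, φ)` is a direct system over `I` in the category of normed `L⁰(μ)`-modules:
`φ i i = id` and `φ i k = φ j k ∘ φ i j` for `i ≤ j ≤ k`. -/
structure IsDirectSystem {I : Type w} [PartialOrder I] (M : I → NormedL0Module.{uX, v} μ)
    (φ : ∀ i j, i ≤ j → Hom (M i) (M j)) : Prop where
  map_self : ∀ (i : I) (a : M i), φ i i le_rfl a = a
  map_map : ∀ (i j k : I) (hij : i ≤ j) (hjk : j ≤ k) (a : M i),
    φ j k hjk (φ i j hij a) = φ i k (hij.trans hjk) a

/-- `(N, ψ)` is a target of `(M, φ)`: `ψ j ∘ φ i j = ψ i` for `i ≤ j`. -/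
def IsTarget {I : Type w} [PartialOrder I] (M : I → NormedL0Module.{uX, v} μ)
    (φ : ∀ i j, i ≤ j → Hom (M i) (M j))
    (N : NormedL0Module.{uX, v} μ) (ψ : ∀ i, Hom (M i) N) : Prop :=
  ∀ (i j : I) (hij : i ≤ j) (a : M i), ψ j (φ i j hij a) = ψ i a

/-- `(L, φ')` is the direct limit of `(M, φ)` in the category of normed `L⁰(μ)`-modules: it is a
target, and every target factors uniquely through it. -/
structure IsDirectLimit {I : Type w} [PartialOrder I] (M : I → NormedL0Module.{uX, v} μ)
    (φ : ∀ i j, i ≤ j → Hom (M i) (M j))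
    (L : NormedL0Module.{uX, v} μ) (φ' : ∀ i, Hom (M i) L) : Prop where
  isTarget : IsTarget M φ L φ'
  existsUnique : ∀ (N : NormedL0Module.{uX, v} μ) (ψ : ∀ i, Hom (M i) N), IsTarget M φ N ψ →
    ∃! Φ : Hom L N, ∀ (i : I) (a : M i), Φ (φ' i a) = ψ i a

end

section Pullback

variable {X : Type uX} {Y : Type uY} [MeasurableSpace X] [MeasurableSpace Y]
  {μ : Measure X} {ν : Measure Y} [SFinite μ] [SFinite ν] {f : X → Y}

/-- A pullback of the normed `L⁰(ν)`-module `M` under `f`: a couple `(f^*M, f^*)` of a normed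
`L⁰(μ)`-module and a (real-)linear map `f^* : M → f^*M` with `|f^* a| = |a| ∘ f` a.e., such that the
image of `f^*` generates `f^*M`. A real `c` acts as the constant function `c`. -/
structure Pullback (hf : QuasiMeasurePreserving f μ ν) (M : NormedL0Module.{uY, v} ν) where
  obj : NormedL0Module.{uX, w} μ
  map : M → obj
  map_add : ∀ a b, map (a + b) = map a + map b
  map_smul : ∀ (c : ℝ) (a : M),
    map ((AEEqFun.const Y c : L0 ν) • a) = (AEEqFun.const X c : L0 μ) • map a
  ptNorm_map : ∀ a, obj.ptNorm (map a) = (M.ptNorm a).compQuasiMeasurePreserving f hf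
  generates : obj.Generates (Set.range map)

/-- `ψ` is the pullback `f^*φ` of the morphism `φ`: it satisfies `f^*φ ∘ f^* = f^* ∘ φ`. -/
def IsPullbackHom {hf : QuasiMeasurePreserving f μ ν} {M N : NormedL0Module.{uY, v} ν}
    (P : Pullback.{uX, uY, v, w} hf M) (Q : Pullback.{uX, uY, v, w} hf N) (φ : Hom M N)
    (ψ : Hom P.obj Q.obj) : Prop :=
  ∀ a, ψ (P.map a) = Q.map (φ a)

end Pullback

end NormedL0Module

/-! A direct limit is recognised by two intrinsic properties. A target `(L, φ')` of the system is a
direct limit exactly when the ranges of the `φ' i` have dense union and `|φ' i a|` is the essential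
infimum of `|φ i j a|` over `j ≥ i`. Since `|φ' i a| ≤ |φ i j a|` for every target, this says that
the norm of `L` is the largest one possible.

Sufficiency (`isDirectLimit_of_normIsInf`): any other target has pointwise norm at most this
infimum, so the map it induces on the algebraic direct limit is bounded by the norm of `L` and
extends by density (`exists_hom_of_dense`). Necessity (`IsDirectLimit.normIsInf_and_dense`):
completing the algebraic limit under the infimum seminorm gives one direct limit with both
properties, and any other is isomorphic to it.

Both properties survive pullback. An essential infimum is the pointwise infimum of a countable
subfamily (`exists_seq_iInf_le`), hence is preserved by composition with `f`; this gives the norm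
formula on the elements `f^* a`.

Passing from these elements to their `L0`-span uses locality instead of partitions and simple
functions: for `g` in `L0` the essential infimum over real `r` of `|g - r|` is zero. So an estimate
valid for real combinations, up to errors `|g - r| * t`, is valid for `L0`-combinations
(`le_of_forall_const`, `LocClosed.span_subset`). The same device builds pullbacks and pullback
morphisms. -/

namespace L0

/-! ### The pointwise order on `L0`. -/

section Order

variable {X : Type*} [MeasurableSpace X] {μ : Measure X}

theorem le_iff {a b : L0 μ} : a ≤ b ↔ ∀ᵐ x ∂μ, a x ≤ b x := AEEqFun.coeFn_le.symm

theorem ext_iff' {a b : L0 μ} : a = b ↔ ∀ᵐ x ∂μ, a x = b x :=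
  ⟨fun h => by rw [h]; exact ae_of_all _ fun _ => rfl, fun h => AEEqFun.ext h⟩

theorem coe_zero : ∀ᵐ x ∂μ, (0 : L0 μ) x = 0 := AEEqFun.coeFn_zero

theorem coe_one : ∀ᵐ x ∂μ, (1 : L0 μ) x = 1 := AEEqFun.coeFn_one

theorem coe_add (a b : L0 μ) : ∀ᵐ x ∂μ, (a + b) x = a x + b x := AEEqFun.coeFn_add a b

theorem coe_sub (a b : L0 μ) : ∀ᵐ x ∂μ, (a - b) x = a x - b x := AEEqFun.coeFn_sub a b

theorem coe_mul (a b : L0 μ) : ∀ᵐ x ∂μ, (a * b) x = a x * b x := AEEqFun.coeFn_mul a b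

theorem coe_abs (a : L0 μ) : ∀ᵐ x ∂μ, |a| x = |a x| := AEEqFun.coeFn_abs a

theorem coe_const (c : ℝ) : ∀ᵐ x ∂μ, (AEEqFun.const X c : L0 μ) x = c := AEEqFun.coeFn_const X c

instance : IsOrderedAddMonoid (L0 μ) where
  add_le_add_left a b h c := by
    rw [le_iff] at *
    filter_upwards [h, coe_add a c, coe_add b c] with x h1 h2 h3
    rw [h2, h3]; linarith

instance : ZeroLEOneClass (L0 μ) where
  zero_le_one := by
    rw [le_iff]
    filter_upwards [coe_zero (μ := μ), coe_one (μ := μ)] with x h1 h2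
    rw [h1, h2]; exact zero_le_one

instance : IsOrderedRing (L0 μ) := .of_mul_nonneg fun a b ha hb => by
  rw [le_iff] at *
  filter_upwards [ha, hb, coe_mul a b, coe_zero (μ := μ)] with x h1 h2 h3 h4
  rw [h4] at h1 h2
  rw [h3, h4]
  exact mul_nonneg h1 h2

theorem abs_mul' (a b : L0 μ) : |a * b| = |a| * |b| := by
  rw [ext_iff']
  filter_upwards [coe_abs (a * b), coe_mul a b, coe_mul |a| |b|, coe_abs a, coe_abs b]
    with x h1 h2 h3 h4 h5
  rw [h1, h2, h3, h4, h5, abs_mul]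

theorem abs_one' : |(1 : L0 μ)| = 1 := abs_of_nonneg zero_le_one

/-- The ring homomorphism sending a real number to the constant function. -/
noncomputable def constHom (μ : Measure X) : ℝ →+* L0 μ where
  toFun c := AEEqFun.const X c
  map_one' := rfl
  map_zero' := rfl
  map_add' _ _ := rfl
  map_mul' _ _ := rfl

theorem coe_constHom (c : ℝ) : ∀ᵐ x ∂μ, constHom μ c x = c := coe_const c

theorem abs_constHom (c : ℝ) : |constHom μ c| = constHom μ |c| := by
  rw [ext_iff']
  filter_upwards [coe_abs (constHom μ c), coe_constHom (μ := μ) c, coe_constHom (μ := μ) |c|]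
    with x h1 h2 h3
  rw [h1, h2, h3]

/-- `h ≤ k` as soon as it holds up to errors `|g - r| * t` for all real constants `r`. -/
theorem le_of_forall_const {h k g t : L0 μ}
    (H : ∀ r : ℝ, h ≤ k + |g - constHom μ r| * t) : h ≤ k := by
  -- Rational `r` allow a single null set; off it, continuity in `r` permits `r = g x`, where the
  -- error vanishes.
  have H' : ∀ r : ℚ, ∀ᵐ x ∂μ, h x ≤ k x + |g x - r| * t x := fun r => by
    have := le_iff.1 (H r)
    filter_upwards [this, coe_add k (|g - constHom μ r| * t), coe_mul |g - constHom μ r| t,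
      coe_abs (g - constHom μ r), coe_sub g (constHom μ r), coe_constHom (μ := μ) (r : ℝ)]
      with x h1 h2 h3 h4 h5 h6
    rwa [h2, h3, h4, h5, h6] at h1
  rw [le_iff]
  filter_upwards [ae_all_iff.2 H'] with x hx
  have hc : Continuous fun r : ℝ => k x + |g x - r| * t x := by fun_prop
  have hcl : IsClosed {r : ℝ | h x ≤ k x + |g x - r| * t x} := isClosed_le continuous_const hc
  have : (g x) ∈ {r : ℝ | h x ≤ k x + |g x - r| * t x} := by
    have hd := Rat.denseRange_cast (𝕜 := ℝ)
    exact hd.induction_on (p := fun r : ℝ => h x ≤ k x + |g x - r| * t x) (g x) hcl hx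
  simpa using this

end Order

/-! ### The metric topology of `L0`: convergence in measure. -/

section Size

variable {X : Type*} [MeasurableSpace X] {μ : Measure X} [SFinite μ]

theorem integrable_min (h : L0 μ) : Integrable (fun x => min |h x| 1) μ.toFinite := by
  have hm : AEStronglyMeasurable (fun x => min |h x| 1) μ.toFinite := by
    have := h.aestronglyMeasurable.mono_ac (toFinite_absolutelyContinuous μ)
    exact (continuous_abs.comp_aestronglyMeasurable this).inf aestronglyMeasurable_const
  refine Integrable.of_bound hm 1 (ae_of_all _ fun x => ?_)
  rw [Real.norm_eq_abs, abs_of_nonneg (le_min (abs_nonneg _) zero_le_one)]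
  exact min_le_right _ _

theorem ae_toFinite' {p : X → Prop} (h : ∀ᵐ x ∂μ, p x) : ∀ᵐ x ∂μ.toFinite, p x := by
  rwa [ae_toFinite]

theorem size_mono_ae {a b : L0 μ} (h : ∀ᵐ x ∂μ, |a x| ≤ |b x|) : size a ≤ size b :=
  integral_mono_ae (integrable_min a) (integrable_min b) <| by
    filter_upwards [ae_toFinite' h] with x hx using min_le_min_right _ hx

theorem size_mono {a b : L0 μ} (h0 : 0 ≤ a) (h : a ≤ b) : size a ≤ size b := by
  apply size_mono_ae
  filter_upwards [le_iff.1 h0, le_iff.1 h, coe_zero (μ := μ)] with x h1 h2 h3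
  rw [h3] at h1
  rwa [abs_of_nonneg h1, abs_of_nonneg (h1.trans h2)]

theorem size_abs (a : L0 μ) : size |a| = size a := by
  apply le_antisymm <;> apply size_mono_ae <;>
    filter_upwards [coe_abs a] with x hx <;> rw [hx, abs_abs]

theorem size_zero : size (0 : L0 μ) = 0 := by
  rw [size, integral_eq_zero_of_ae]
  filter_upwards [ae_toFinite' (coe_zero (μ := μ))] with x hx
  simp [hx]

theorem size_add_le (a b : L0 μ) : size (a + b) ≤ size a + size b := by
  rw [size, size, size, ← integral_add (integrable_min a) (integrable_min b)]
  refine integral_mono_ae (integrable_min _) ((integrable_min a).add (integrable_min b)) ?_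
  filter_upwards [ae_toFinite' (coe_add a b)] with x hx
  simp only [hx]
  have h1 := abs_add_le (a x) (b x)
  have h2 := abs_nonneg (a x)
  have h3 := abs_nonneg (b x)
  rcases le_total |a x| 1 with h4 | h4 <;> rcases le_total |b x| 1 with h5 | h5 <;>
    simp only [h4, h5, min_eq_left, min_eq_right] <;>
    first
    | exact (min_le_left _ _).trans h1
    | exact (min_le_right _ _).trans (by linarith)

theorem size_neg (a : L0 μ) : size (-a) = size a := by
  rw [← size_abs, abs_neg, size_abs]

theorem size_eq_zero {a : L0 μ} (h : size a = 0) : a = 0 := by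
  rw [size, integral_eq_zero_iff_of_nonneg (fun x => le_min (abs_nonneg _) zero_le_one)
    (integrable_min a)] at h
  rw [ext_iff']
  have h' : ∀ᵐ x ∂μ, min |a x| 1 = 0 := by
    have : ∀ᵐ x ∂μ.toFinite, min |a x| 1 = 0 := h
    rwa [ae_toFinite] at this
  filter_upwards [h', coe_zero (μ := μ)] with x h1 h2
  rw [h2]
  rcases min_choice |a x| 1 with h3 | h3 <;> rw [h3] at h1
  · exact abs_eq_zero.1 h1
  · norm_num at h1

/-- The norm `‖h‖ = ∫ |h| ∧ 1 dm'` on the additive group `L0 μ`. -/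
noncomputable instance : NormedAddCommGroup (X →ₘ[μ] ℝ) :=
  AddGroupNorm.toNormedAddCommGroup
    { toFun := fun h : L0 μ => size h
      map_zero' := size_zero
      add_le' := size_add_le
      neg' := size_neg
      eq_zero_of_map_eq_zero' := fun _ => size_eq_zero }

theorem norm_def (h : L0 μ) : ‖h‖ = size h := rfl

theorem dist_def (a b : L0 μ) : dist a b = size (a - b) := by rw [dist_eq_norm]; rfl

theorem norm_abs' (h : L0 μ) : ‖|h|‖ = ‖h‖ := size_abs h

theorem norm_mono {a b : L0 μ} (h0 : 0 ≤ a) (h : a ≤ b) : ‖a‖ ≤ ‖b‖ := size_mono h0 h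

/-- `h ≤ k` as soon as it holds up to errors of arbitrarily small norm. -/
theorem le_of_forall_norm {h k : L0 μ}
    (H : ∀ ε : ℝ, 0 < ε → ∃ r : L0 μ, ‖r‖ < ε ∧ h ≤ k + r) : h ≤ k := by
  have : ‖(h - k) ⊔ 0‖ = 0 := by
    refine le_antisymm (le_of_forall_pos_lt_add fun ε hε => ?_) (norm_nonneg _)
    obtain ⟨r, hr, hle⟩ := H ε hε
    rw [zero_add]
    refine lt_of_le_of_lt ?_ hr
    rw [← norm_abs' r]
    refine norm_mono le_sup_right (sup_le ?_ (abs_nonneg r))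
    exact (sub_le_iff_le_add'.2 hle).trans (le_abs_self r)
  have h2 : (h - k) ⊔ 0 = 0 := norm_eq_zero.1 this
  exact sub_nonpos.1 (sup_eq_right.1 h2)

instance : OrderClosedTopology (X →ₘ[μ] ℝ) where
  isClosed_le' := by
    refine isClosed_of_closure_subset fun p hp => ?_
    refine le_of_forall_norm fun ε hε => ?_
    obtain ⟨q, hq, hd⟩ := Metric.mem_closure_iff.1 hp (ε / 2) (half_pos hε)
    rw [Prod.dist_eq, max_lt_iff, dist_eq_norm, dist_eq_norm] at hd
    refine ⟨(p.1 - q.1) - (p.2 - q.2), ?_, ?_⟩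
    · linarith [norm_sub_le (p.1 - q.1) (p.2 - q.2), hd.1, hd.2]
    · have hq' : q.1 ≤ q.2 := hq
      calc p.1 = p.2 + ((p.1 - q.1) - (p.2 - q.2)) + (q.1 - q.2) := by abel
        _ ≤ p.2 + ((p.1 - q.1) - (p.2 - q.2)) + 0 := by
          gcongr; exact sub_nonpos.2 hq'
        _ = _ := add_zero _

theorem tendsto_zero_of_ae {h : ℕ → L0 μ}
    (H : ∀ᵐ x ∂μ, Tendsto (fun n => h n x) atTop (𝓝 0)) : Tendsto h atTop (𝓝 0) := by
  rw [tendsto_zero_iff_norm_tendsto_zero]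
  have h0 : (0 : ℝ) = ∫ _, (0 : ℝ) ∂μ.toFinite := by simp
  rw [h0]
  refine tendsto_integral_of_dominated_convergence (fun _ => 1)
    (fun n => (integrable_min (h n)).1) (integrable_const _) (fun n => ae_of_all _ fun x => ?_) ?_
  · rw [Real.norm_eq_abs, abs_of_nonneg (le_min (abs_nonneg _) zero_le_one)]
    exact min_le_right _ _
  · filter_upwards [ae_toFinite' H] with x hx
    have := (hx.abs).min (tendsto_const_nhds (x := (1 : ℝ)))
    simpa using this

/-- The truncations converge in `L¹`, hence in measure, hence a.e. along a subsequence. Where `min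
|h| 1` tends to zero it is eventually below `1`, so the truncation is inactive. -/
theorem exists_seq_ae_tendsto_zero {h : ℕ → L0 μ} (H : Tendsto h atTop (𝓝 0)) :
    ∃ ns : ℕ → ℕ, StrictMono ns ∧ ∀ᵐ x ∂μ, Tendsto (fun n => h (ns n) x) atTop (𝓝 0) := by
  rw [tendsto_zero_iff_norm_tendsto_zero] at H
  have key : TendstoInMeasure μ.toFinite (fun n x => min |h n x| 1) atTop (fun _ => 0) := by
    refine tendstoInMeasure_of_tendsto_eLpNorm (p := 1) one_ne_zero
      (fun n => (integrable_min (h n)).1) aestronglyMeasurable_const ?_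
    have e : ∀ n, eLpNorm ((fun x => min |h n x| 1) - fun _ => 0) 1 μ.toFinite
        = ENNReal.ofReal ‖h n‖ := fun n => by
      have e1 : ((fun x => min |h n x| 1) - fun _ => (0 : ℝ)) = fun x => min |h n x| 1 := by
        ext x; simp
      rw [e1, eLpNorm_one_eq_lintegral_enorm, norm_def, size,
        ← ofReal_integral_norm_eq_lintegral_enorm (integrable_min (h n))]
      congr 2
      ext x
      rw [Real.norm_eq_abs, abs_of_nonneg (le_min (abs_nonneg _) zero_le_one)]
    simp_rw [e]
    simpa using ENNReal.tendsto_ofReal H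
  obtain ⟨ns, hns, hae⟩ := key.exists_seq_tendsto_ae
  refine ⟨ns, hns, ?_⟩
  rw [ae_toFinite] at hae
  filter_upwards [hae] with x hx
  rw [tendsto_zero_iff_abs_tendsto_zero]
  refine Tendsto.congr' ?_ hx
  have : ∀ᶠ n in atTop, min |h (ns n) x| 1 < 1 := hx.eventually (gt_mem_nhds zero_lt_one)
  filter_upwards [this] with n hn
  rcases min_choice |h (ns n) x| 1 with h3 | h3
  · exact h3
  · rw [h3] at hn; exact absurd hn (lt_irrefl _)

/-- Multiplication and composition need not be Lipschitz for the metric, but they preserve a.e.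
convergence. Every subsequence has a further one converging a.e., which is enough. -/
theorem tendsto_zero_map {Y : Type*} [MeasurableSpace Y] {ν : Measure Y} [SFinite ν]
    (A : L0 ν → L0 μ)
    (hA : ∀ h : ℕ → L0 ν, (∀ᵐ y ∂ν, Tendsto (fun n => h n y) atTop (𝓝 0)) →
      ∀ᵐ x ∂μ, Tendsto (fun n => A (h n) x) atTop (𝓝 0))
    {h : ℕ → L0 ν} (H : Tendsto h atTop (𝓝 0)) :
    Tendsto (fun n => A (h n)) atTop (𝓝 0) := by
  refine tendsto_of_subseq_tendsto fun ns hns => ?_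
  obtain ⟨ms, _, hae⟩ := exists_seq_ae_tendsto_zero (H.comp hns)
  exact ⟨ms, tendsto_zero_of_ae (hA _ hae)⟩

theorem tendsto_mul_zero (g : L0 μ) {h : ℕ → L0 μ} (H : Tendsto h atTop (𝓝 0)) :
    Tendsto (fun n => g * h n) atTop (𝓝 0) := by
  refine tendsto_zero_map (fun h => g * h) (fun h hh => ?_) H
  filter_upwards [hh, ae_all_iff.2 fun n => coe_mul g (h n)] with x h1 h2
  simp_rw [h2]
  simpa using h1.const_mul (g x)

theorem tendsto_comp_zero {Y : Type*} [MeasurableSpace Y] {ν : Measure Y} [SFinite ν]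
    {f : X → Y} (hf : QuasiMeasurePreserving f μ ν)
    {h : ℕ → L0 ν} (H : Tendsto h atTop (𝓝 0)) :
    Tendsto (fun n => (h n).compQuasiMeasurePreserving f hf) atTop (𝓝 0) := by
  refine tendsto_zero_map (fun h => h.compQuasiMeasurePreserving f hf) (fun h hh => ?_) H
  filter_upwards [hf.ae hh, ae_all_iff.2 fun n =>
    AEEqFun.coeFn_compQuasiMeasurePreserving (h n) hf] with x h1 h2
  simp_rw [h2]
  exact h1

end Size

end L0

/-! ### Completeness of `L0`. -/

namespace L0

section Complete

variable {X : Type*} [MeasurableSpace X] {μ : Measure X} [SFinite μ]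

/-- The truncated increments have summable integrals, so they are summable at a.e. point. There they
are eventually below `1`, hence equal to the true increments. -/
theorem ae_cauchySeq_of_dist_lt {u : ℕ → L0 μ} (hu : ∀ n, dist (u n) (u (n + 1)) < (1 / 2) ^ n) :
    ∀ᵐ x ∂μ, CauchySeq fun n => u n x := by
  set F : ℕ → X → ℝ := fun n x => min |(u n - u (n + 1)) x| 1 with hF
  have hF0 : ∀ n x, 0 ≤ F n x := fun n x => le_min (abs_nonneg _) zero_le_one
  have hint : ∀ n, ∫⁻ x, ENNReal.ofReal (F n x) ∂μ.toFinite
      = ENNReal.ofReal (dist (u n) (u (n + 1))) := fun n => by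
    rw [dist_def, size, ofReal_integral_eq_lintegral_ofReal (integrable_min _)
      (ae_of_all _ (hF0 n))]
  have htsum : ∫⁻ x, ∑' n, ENNReal.ofReal (F n x) ∂μ.toFinite ≠ ⊤ := by
    rw [lintegral_tsum fun n => (integrable_min _).1.aemeasurable.ennreal_ofReal]
    rw [tsum_congr hint]
    have hs : Summable fun n => dist (u n) (u (n + 1)) :=
      Summable.of_nonneg_of_le (fun _ => dist_nonneg) (fun n => (hu n).le) summable_geometric_two
    exact hs.tsum_ofReal_ne_top
  have hae : ∀ᵐ x ∂μ, ∑' n, ENNReal.ofReal (F n x) < ⊤ := by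
    have := ae_lt_top' (AEMeasurable.tsum fun n =>
      (integrable_min (u n - u (n + 1))).1.aemeasurable.ennreal_ofReal) htsum
    rwa [ae_toFinite] at this
  filter_upwards [hae, ae_all_iff.2 fun n => coe_sub (u n) (u (n + 1))] with x hx hsub
  have hsum : Summable fun n => F n x := by
    have := ENNReal.summable_toReal hx.ne
    simpa [ENNReal.toReal_ofReal (hF0 _ _)] using this
  have hev : ∀ᶠ n in atTop, F n x = dist (u n x) (u (n + 1) x) := by
    filter_upwards [hsum.tendsto_atTop_zero.eventually (gt_mem_nhds zero_lt_one)] with n hn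
    simp only [hF, hsub] at hn ⊢
    rcases min_choice |u n x - u (n + 1) x| 1 with h3 | h3
    · rw [h3, Real.dist_eq]
    · rw [h3] at hn; exact absurd hn (lt_irrefl _)
  refine cauchySeq_of_summable_dist (f := fun n => u n x) ?_
  exact (summable_congr_atTop hev).1 hsum

instance : CompleteSpace (X →ₘ[μ] ℝ) := by
  refine Metric.complete_of_convergent_controlled_sequences (fun n => (1 / 2) ^ n)
    (fun n => by positivity) fun u hu => ?_
  have hc := ae_cauchySeq_of_dist_lt fun n => hu n n (n + 1) le_rfl n.le_succ
  obtain ⟨g, hg, hlim⟩ := exists_stronglyMeasurable_limit_of_tendsto_ae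
    (fun n => (u n).aestronglyMeasurable) (hc.mono fun x hx => cauchySeq_tendsto_of_complete hx)
  refine ⟨AEEqFun.mk g hg.aestronglyMeasurable, ?_⟩
  rw [← tendsto_sub_nhds_zero_iff]
  refine tendsto_zero_of_ae ?_
  filter_upwards [hlim, AEEqFun.coeFn_mk g hg.aestronglyMeasurable, ae_all_iff.2 fun n =>
    coe_sub (u n) (AEEqFun.mk g hg.aestronglyMeasurable)] with x h1 h2 h3
  simp_rw [h3, h2]
  exact tendsto_sub_nhds_zero_iff.2 h1

end Complete

/-! ### Essential infima. -/

section EssInf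

variable {X : Type*} [MeasurableSpace X] {μ : Measure X} {ι : Type*} {F : ι → L0 μ}

theorem aemeasurable_iInf (s : ℕ → ι) : AEMeasurable (fun x => ⨅ n, F (s n) x) μ :=
  AEMeasurable.iInf fun n => (F (s n)).aestronglyMeasurable.aemeasurable

theorem ae_bddBelow (hF : ∀ i, 0 ≤ F i) (s : ℕ → ι) :
    ∀ᵐ x ∂μ, BddBelow (Set.range fun n => F (s n) x) := by
  filter_upwards [ae_all_iff.2 fun n => le_iff.1 (hF (s n)), coe_zero (μ := μ)] with x h1 h2
  refine ⟨0, ?_⟩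
  rintro _ ⟨n, rfl⟩
  exact h2 ▸ h1 n

variable [SFinite μ]

theorem integrable_arctan {g : X → ℝ} (hg : AEMeasurable g μ) :
    Integrable (fun x => Real.arctan (g x)) μ.toFinite := by
  have hm : AEStronglyMeasurable (fun x => Real.arctan (g x)) μ.toFinite :=
    (Real.measurable_arctan.comp_aemeasurable
      (hg.mono_ac (toFinite_absolutelyContinuous μ))).aestronglyMeasurable
  refine Integrable.of_bound hm (Real.pi / 2) (ae_of_all _ fun x => ?_)
  rw [Real.norm_eq_abs, abs_le]
  exact ⟨(Real.neg_pi_div_two_lt_arctan _).le, (Real.arctan_lt_pi_div_two _).le⟩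

/-- A family of nonnegative elements of `L0 μ` has an essential infimum, which is the pointwise
infimum of a countable subfamily. -/
theorem exists_seq_iInf_le [Nonempty ι] (hF : ∀ i, 0 ≤ F i) :
    ∃ s : ℕ → ι, ∀ i, ∀ᵐ x ∂μ, ⨅ n, F (s n) x ≤ F i x := by
  -- The sequence sought minimises `J`. Since `arctan` is bounded, every `J s` is finite; since it
  -- is strictly increasing, equality of integrals of ordered infima forces a.e. equality of the
  -- infima.
  let J : (ℕ → ι) → ℝ := fun s => ∫ x, Real.arctan (⨅ n, F (s n) x) ∂μ.toFinite
  have hJ0 : ∀ s, 0 ≤ J s := fun s => by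
    refine integral_nonneg_of_ae ?_
    filter_upwards [ae_toFinite' (ae_all_iff.2 fun n => le_iff.1 (hF (s n))),
      ae_toFinite' (coe_zero (μ := μ))] with x h1 h2
    exact Real.arctan_nonneg.2 (Real.iInf_nonneg fun n => h2 ▸ h1 n)
  have hbdd : BddBelow (Set.range J) := ⟨0, by rintro _ ⟨s, rfl⟩; exact hJ0 s⟩
  have hmono : ∀ s t : ℕ → ι, Set.range s ⊆ Set.range t →
      ∀ᵐ x ∂μ, ⨅ n, F (t n) x ≤ ⨅ n, F (s n) x := fun s t hst => by
    filter_upwards [ae_bddBelow hF t] with x hx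
    refine le_ciInf fun n => ?_
    obtain ⟨m, hm⟩ := hst ⟨n, rfl⟩
    rw [← hm]
    exact ciInf_le hx m
  have hJmono : ∀ s t : ℕ → ι, Set.range s ⊆ Set.range t → J t ≤ J s := fun s t hst => by
    refine integral_mono_ae (integrable_arctan (aemeasurable_iInf t))
      (integrable_arctan (aemeasurable_iInf s)) ?_
    filter_upwards [ae_toFinite' (hmono s t hst)] with x hx
    exact Real.arctan_strictMono.monotone hx
  have hex : ∀ k : ℕ, ∃ s, J s < (⨅ s, J s) + 1 / ((k : ℝ) + 1) := fun k =>
    exists_lt_of_ciInf_lt (lt_add_of_pos_right _ Nat.one_div_pos_of_nat)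
  choose S hS using hex
  -- Interleaving all members of a minimising family attains the infimum of `J`.
  let s : ℕ → ι := fun n => S n.unpair.1 n.unpair.2
  have hs : ∀ t, J s ≤ J t := fun t => by
    refine le_trans ?_ (ciInf_le hbdd t)
    refine le_of_forall_pos_lt_add fun ε hε => ?_
    obtain ⟨k, hk⟩ := exists_nat_one_div_lt hε
    have : J s ≤ J (S k) := hJmono _ _ <| by
      rintro _ ⟨n, rfl⟩
      exact ⟨Nat.pair k n, by simp [s]⟩
    linarith [hS k]
  refine ⟨s, fun i => ?_⟩
  -- Prepending `i` to a minimiser cannot lower `J`, so the infimum along `s` is already below `F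
  -- i`.
  let t : ℕ → ι := fun n => Nat.casesOn n i s
  have hst : Set.range s ⊆ Set.range t := by
    rintro _ ⟨n, rfl⟩
    exact ⟨n + 1, rfl⟩
  have heq := (integral_eq_iff_of_ae_le (integrable_arctan (aemeasurable_iInf t))
    (integrable_arctan (aemeasurable_iInf s)) (by
      filter_upwards [ae_toFinite' (hmono s t hst)] with x hx
      exact Real.arctan_strictMono.monotone hx)).1 (le_antisymm (hJmono s t hst) (hs t))
  have heq' : ∀ᵐ x ∂μ, Real.arctan (⨅ n, F (t n) x) = Real.arctan (⨅ n, F (s n) x) := by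
    rwa [EventuallyEq, ae_toFinite] at heq
  filter_upwards [heq', ae_bddBelow hF t] with x h1 h2
  rw [← Real.arctan_injective h1]
  exact ciInf_le h2 0

theorem exists_isGLB [Nonempty ι] (hF : ∀ i, 0 ≤ F i) : ∃ m, IsGLB (Set.range F) m := by
  obtain ⟨s, hs⟩ := exists_seq_iInf_le hF
  refine ⟨AEEqFun.mk _ (aemeasurable_iInf (F := F) s).aestronglyMeasurable, ?_, ?_⟩
  · rintro _ ⟨i, rfl⟩
    rw [le_iff]
    filter_upwards [hs i, AEEqFun.coeFn_mk _ (aemeasurable_iInf (F := F) s).aestronglyMeasurable]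
      with x h1 h2
    rwa [h2]
  · intro h hh
    rw [le_iff]
    filter_upwards [ae_all_iff.2 fun n => le_iff.1 (hh ⟨s n, rfl⟩),
      AEEqFun.coeFn_mk _ (aemeasurable_iInf (F := F) s).aestronglyMeasurable] with x h1 h2
    rw [h2]
    exact le_ciInf h1

theorem exists_seq_ae_eq_iInf [Nonempty ι] (hF : ∀ i, 0 ≤ F i) {m : L0 μ}
    (hm : IsGLB (Set.range F) m) : ∃ s : ℕ → ι, ∀ᵐ x ∂μ, m x = ⨅ n, F (s n) x := by
  obtain ⟨s, hs⟩ := exists_seq_iInf_le hF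
  refine ⟨s, ?_⟩
  have h1 : AEEqFun.mk _ (aemeasurable_iInf (F := F) s).aestronglyMeasurable ≤ m := by
    refine hm.2 ?_
    rintro _ ⟨i, rfl⟩
    rw [le_iff]
    filter_upwards [hs i, AEEqFun.coeFn_mk _ (aemeasurable_iInf (F := F) s).aestronglyMeasurable]
      with x h1 h2
    rwa [h2]
  filter_upwards [le_iff.1 h1, AEEqFun.coeFn_mk _
    (aemeasurable_iInf (F := F) s).aestronglyMeasurable,
    ae_all_iff.2 fun n => le_iff.1 (hm.1 ⟨s n, rfl⟩)] with x h1 h2 h3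
  rw [h2] at h1
  exact le_antisymm (le_ciInf h3) h1

/-- Represented as a countable pointwise infimum, the bound commutes with multiplication by a
nonnegative function. -/
theorem le_mul_of_isGLB [Nonempty ι] (hF : ∀ i, 0 ≤ F i) {m g h : L0 μ} (hg : 0 ≤ g)
    (hm : IsGLB (Set.range F) m) (hh : ∀ i, h ≤ g * F i) : h ≤ g * m := by
  obtain ⟨s, hs⟩ := exists_seq_ae_eq_iInf hF hm
  rw [le_iff]
  filter_upwards [hs, ae_all_iff.2 fun n => le_iff.1 (hh (s n)), coe_mul g m,
    ae_all_iff.2 fun n => coe_mul g (F (s n)), le_iff.1 hg, coe_zero (μ := μ)]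
    with x h1 h2 h3 h4 h5 h6
  rw [h6] at h5
  rw [h3, h1, Real.mul_iInf_of_nonneg h5]
  exact le_ciInf fun n => h4 n ▸ h2 n

/-- Essential infima are preserved by composition with a quasi-measure-preserving map. -/
theorem le_comp_of_isGLB {Y : Type*} [MeasurableSpace Y] {ν : Measure Y} {f : Y → X}
    (hf : QuasiMeasurePreserving f ν μ) [Nonempty ι] (hF : ∀ i, 0 ≤ F i) {m : L0 μ} {h : L0 ν}
    (hm : IsGLB (Set.range F) m) (hh : ∀ i, h ≤ (F i).compQuasiMeasurePreserving f hf) :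
    h ≤ m.compQuasiMeasurePreserving f hf := by
  obtain ⟨s, hs⟩ := exists_seq_ae_eq_iInf hF hm
  rw [le_iff]
  filter_upwards [hf.ae hs, ae_all_iff.2 fun n => le_iff.1 (hh (s n)),
    AEEqFun.coeFn_compQuasiMeasurePreserving m hf, ae_all_iff.2 fun n =>
    AEEqFun.coeFn_compQuasiMeasurePreserving (F (s n)) hf] with x h1 h2 h3 h4
  rw [h3, Function.comp, h1]
  exact le_ciInf fun n => by simpa [h4] using h2 n

end EssInf

end L0

/-! ### Pointwise seminorms and locality. -/

/-- A pointwise seminorm with values in `L0 μ` on an `L0 μ`-module. -/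
structure L0Seminorm {X : Type*} [MeasurableSpace X] (μ : Measure X) (E : Type*)
    [AddCommGroup E] [Module (L0 μ) E] where
  toFun : E → L0 μ
  nonneg' : ∀ a, 0 ≤ toFun a
  add_le' : ∀ a b, toFun (a + b) ≤ toFun a + toFun b
  smul' : ∀ (g : L0 μ) a, toFun (g • a) = |g| * toFun a

namespace L0Seminorm

section Basic

variable {X : Type*} [MeasurableSpace X] {μ : Measure X} {E : Type*} [AddCommGroup E]
  [Module (L0 μ) E]

instance : CoeFun (L0Seminorm μ E) (fun _ => E → L0 μ) := ⟨toFun⟩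

variable (p : L0Seminorm μ E)

theorem nonneg (a : E) : 0 ≤ p a := p.nonneg' a

theorem add_le (a b : E) : p (a + b) ≤ p a + p b := p.add_le' a b

theorem smul (g : L0 μ) (a : E) : p (g • a) = |g| * p a := p.smul' g a

theorem map_zero : p 0 = 0 := by
  have := p.smul 0 0
  rwa [zero_smul, abs_zero, zero_mul] at this

theorem map_neg (a : E) : p (-a) = p a := by
  have := p.smul (-1) a
  rwa [neg_smul, one_smul, abs_neg, L0.abs_one', one_mul] at this

theorem map_sub_comm (a b : E) : p (a - b) = p (b - a) := by rw [← neg_sub, map_neg]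

theorem le_add_sub (a b : E) : p a ≤ p b + p (a - b) := by
  simpa using p.add_le b (a - b)

theorem le_add_sub' (a b : E) : p a ≤ p b + p (b - a) := by
  rw [p.map_sub_comm]; exact p.le_add_sub a b

theorem abs_sub_le (a b : E) : |p a - p b| ≤ p (a - b) := by
  refine abs_le'.2 ⟨?_, ?_⟩
  · exact sub_le_iff_le_add'.2 (p.le_add_sub a b)
  · rw [neg_sub]
    exact sub_le_iff_le_add'.2 (p.le_add_sub' b a)

/-- A subadditive map with `p (g • a) ≤ |g| * p a` is a seminorm. -/
noncomputable def ofSMulLE (p : E → L0 μ) (h0 : ∀ a, 0 ≤ p a) (hadd : ∀ a b, p (a + b) ≤ p a + p b)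
    (hsmul : ∀ (g : L0 μ) a, p (g • a) ≤ |g| * p a) : L0Seminorm μ E where
  toFun := p
  nonneg' := h0
  add_le' := hadd
  smul' g a := by
    refine le_antisymm (hsmul g a) ?_
    -- Because `0⁻¹ = 0`, the product `i * g` is the indicator of `{g ≠ 0}`. The missing inequality
    -- comes from applying `hsmul` to `i • (g • a)`; the remainder `(1 - i * g) • a` is killed by
    -- `|g|`.
    let i : L0 μ := g.compMeasurable (fun t : ℝ => t⁻¹) measurable_inv
    have hi : ∀ᵐ x ∂μ, i x = (g x)⁻¹ := AEEqFun.coeFn_compMeasurable _ _ _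
    have hz : |g| * |1 - i * g| = 0 := by
      rw [← L0.abs_mul', L0.ext_iff']
      filter_upwards [L0.coe_abs (g * (1 - i * g)), L0.coe_mul g (1 - i * g),
        L0.coe_sub 1 (i * g), L0.coe_mul i g, L0.coe_one (μ := μ), L0.coe_zero (μ := μ), hi]
        with x h1 h2 h3 h4 h5 h6 h7
      rw [h1, h2, h3, h4, h5, h6, h7]
      by_cases hg : g x = 0
      · simp [hg]
      · simp [hg]
    have hle : |g| * |i| ≤ 1 := by
      rw [← L0.abs_mul', L0.le_iff]
      filter_upwards [L0.coe_abs (g * i), L0.coe_mul g i, L0.coe_one (μ := μ), hi]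
        with x h1 h2 h3 h4
      rw [h1, h2, h3, h4]
      by_cases hg : g x = 0
      · simp [hg]
      · simp [hg]
    have ha : a = i • (g • a) + (1 - i * g) • a := by
      rw [smul_smul, ← add_smul, add_sub_cancel, one_smul]
    calc |g| * p a ≤ |g| * (|i| * p (g • a) + |1 - i * g| * p a) := by
          refine mul_le_mul_of_nonneg_left ?_ (abs_nonneg g)
          conv_lhs => rw [ha]
          exact (hadd _ _).trans (add_le_add (hsmul _ _) (hsmul _ _))
      _ = |g| * |i| * p (g • a) + |g| * |1 - i * g| * p a := by ring
      _ ≤ 1 * p (g • a) + 0 * p a := by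
          rw [hz]
          gcongr
          exact h0 _
      _ = p (g • a) := by ring

/-- The pullback of a seminorm under a linear map. -/
noncomputable def comp {F : Type*} [AddCommGroup F] [Module (L0 μ) F] (p : L0Seminorm μ F)
    (T : E →ₗ[L0 μ] F) : L0Seminorm μ E where
  toFun a := p (T a)
  nonneg' _ := p.nonneg _
  add_le' a b := by rw [_root_.map_add]; exact p.add_le _ _
  smul' g a := by rw [_root_.map_smul, p.smul]

/-- The sum of two seminorms. -/
noncomputable def add (p q : L0Seminorm μ E) : L0Seminorm μ E where
  toFun a := p a + q a
  nonneg' a := add_nonneg (p.nonneg a) (q.nonneg a)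
  add_le' a b := (add_le_add (p.add_le a b) (q.add_le a b)).trans_eq (add_add_add_comm _ _ _ _)
  smul' g a := by rw [p.smul, q.smul, mul_add]

/-- `K` contains every `u` such that the essential infimum of `p (u - a)`, `a ∈ K`, vanishes. -/
def LocClosed (K : Set E) : Prop :=
  ∀ u, (∀ h, (∀ a ∈ K, h ≤ p (u - a)) → h ≤ 0) → u ∈ K

-- In a sum of terms `g • s`, a coefficient `g` may be replaced by a real constant `r` at cost `|g -
-- r| * p s`, and these costs have essential infimum zero. The term `r • s` is then absorbed into
-- the summand from `S`, so the induction hypothesis applies.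
open scoped Pointwise in
theorem LocClosed.span_subset {p : L0Seminorm μ E} {K S : Set E} (hK : p.LocClosed K) (hS : S ⊆ K)
    (h0 : (0 : E) ∈ S) (hadd : ∀ a ∈ S, ∀ b ∈ S, a + b ∈ S)
    (hsmul : ∀ (r : ℝ), ∀ a ∈ S, L0.constHom μ r • a ∈ S) :
    (Submodule.span (L0 μ) S : Set E) ⊆ K := by
  intro u hu
  suffices ∀ a ∈ S, u + a ∈ K by simpa using this 0 h0
  have hu' : u ∈ AddSubmonoid.closure (@Set.univ (L0 μ) • S) := by
    rw [← Submodule.span_eq_closure]; exact hu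
  clear hu
  induction hu' using AddSubmonoid.closure_induction_left with
  | zero => exact fun a ha => by rw [zero_add]; exact hS ha
  | add_left x hx y hy ih =>
    obtain ⟨g, -, s, hs, rfl⟩ := Set.mem_smul.1 hx
    intro a ha
    refine hK _ fun h hh => L0.le_of_forall_const (g := g) (t := p s) fun r => ?_
    have := hh _ (ih _ (hadd a ha _ (hsmul r s hs)))
    rw [show g • s + y + a - (y + (a + L0.constHom μ r • s)) = (g - L0.constHom μ r) • s by
      rw [sub_smul]; abel, p.smul] at this
    rwa [zero_add]

/-- A bound by twice the error is a bound of `h / 2` by the error. The form is convenient when both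
sides of an inequality are perturbed. -/
theorem locClosed_of_add_self {K : Set E}
    (hK : ∀ u, (∀ h, (∀ a ∈ K, h ≤ p (u - a) + p (u - a)) → h ≤ 0) → u ∈ K) : p.LocClosed K :=
  fun u hu => hK u fun h hh => by
    have hpos : ∀ {r : ℝ}, 0 ≤ r → 0 ≤ L0.constHom μ r := fun {r} hr => by
      rw [← abs_of_nonneg hr, ← L0.abs_constHom]; exact abs_nonneg _
    have h2 : L0.constHom μ 2 * L0.constHom μ 2⁻¹ = 1 := by
      rw [← _root_.map_mul, mul_inv_cancel₀ two_ne_zero, map_one]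
    have h3 : L0.constHom μ 2 = 2 := map_ofNat _ 2
    have := hu (L0.constHom μ 2⁻¹ * h) fun a ha => by
      calc _ ≤ L0.constHom μ 2⁻¹ * (p (u - a) + p (u - a)) :=
            mul_le_mul_of_nonneg_left (hh a ha) (hpos (by norm_num))
        _ = L0.constHom μ 2 * L0.constHom μ 2⁻¹ * p (u - a) := by rw [h3]; ring
        _ = _ := by rw [h2, one_mul]
    calc h = L0.constHom μ 2 * (L0.constHom μ 2⁻¹ * h) := by rw [← mul_assoc, h2, one_mul]
      _ ≤ L0.constHom μ 2 * 0 := mul_le_mul_of_nonneg_left this (hpos (by norm_num))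
      _ = 0 := mul_zero _

end Basic

section Topology

variable {X : Type*} [MeasurableSpace X] {μ : Measure X} [SFinite μ] {E : Type*} [AddCommGroup E]
  [Module (L0 μ) E]

/-- The seminorm `‖a‖ = ∫ p a ∧ 1 dm'` induced by a pointwise seminorm. -/
noncomputable abbrev toSeminormedAddCommGroup (p : L0Seminorm μ E) : SeminormedAddCommGroup E :=
  AddGroupSeminorm.toSeminormedAddCommGroup
    { toFun := fun a => ‖p a‖
      map_zero' := by rw [p.map_zero, norm_zero]
      add_le' := fun a b => (L0.norm_mono (p.nonneg _) (p.add_le a b)).trans (norm_add_le _ _)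
      neg' := fun a => by rw [p.map_neg] }

theorem tendsto_smul_zero (p : L0Seminorm μ E) (g : L0 μ) {u : ℕ → E}
    (hu : Tendsto (fun n => p (u n)) atTop (𝓝 0)) :
    Tendsto (fun n => p (g • u n)) atTop (𝓝 0) := by
  simp_rw [p.smul]
  exact L0.tendsto_mul_zero _ hu

/-- The type `E` regarded as a seminormed group by means of `p`. -/
@[nolint unusedArguments]
def Space (_ : L0Seminorm μ E) : Type _ := E

variable (p : L0Seminorm μ E)

noncomputable instance : SeminormedAddCommGroup p.Space := p.toSeminormedAddCommGroup

noncomputable instance : Module (L0 μ) p.Space := inferInstanceAs (Module (L0 μ) E)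

theorem norm_space (a : p.Space) : ‖a‖ = ‖p (show E from a)‖ := rfl

instance : UniformContinuousConstSMul (L0 μ) p.Space where
  uniformContinuous_const_smul g := by
    refine uniformContinuous_of_continuousAt_zero (DistribSMul.toAddMonoidHom p.Space g) ?_
    rw [ContinuousAt, _root_.map_zero, tendsto_nhds_iff_seq_tendsto]
    intro u hu
    rw [tendsto_zero_iff_norm_tendsto_zero] at hu ⊢
    have h := p.tendsto_smul_zero g (u := u) (tendsto_zero_iff_norm_tendsto_zero.2 hu)
    have h' := tendsto_zero_iff_norm_tendsto_zero.1 h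
    exact h'

theorem lipschitz_space : LipschitzWith 1 (fun a : p.Space => p (show E from a)) := by
  refine LipschitzWith.of_dist_le_mul fun a b => ?_
  rw [NNReal.coe_one, one_mul, dist_eq_norm, dist_eq_norm, norm_space, ← L0.norm_abs']
  exact L0.norm_mono (abs_nonneg _) (p.abs_sub_le _ _)

end Topology

end L0Seminorm

/-! ### Normed modules as complete metric groups; extension of morphisms. -/

namespace NormedL0Module

section

variable {X : Type uX} [MeasurableSpace X] {μ : Measure X} [SFinite μ]

/-- The pointwise norm of a normed module as a seminorm. -/
def seminorm (M : NormedL0Module.{uX, v} μ) : L0Seminorm μ M where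
  toFun := M.ptNorm
  nonneg' := M.ptNorm_nonneg
  add_le' := M.ptNorm_add_le
  smul' := M.ptNorm_smul

noncomputable instance (M : NormedL0Module.{uX, v} μ) : NormedAddCommGroup M :=
  { M.seminorm.toSeminormedAddCommGroup with
    eq_of_dist_eq_zero := fun {a b} h => by
      let _ := M.seminorm.toSeminormedAddCommGroup
      have h' : ‖M.ptNorm (a - b)‖ = 0 := by
        have := dist_eq_norm a b
        rw [h] at this
        exact this.symm
      exact sub_eq_zero.1 ((M.ptNorm_eq_zero_iff _).1 (norm_eq_zero.1 h')) }

variable {M : NormedL0Module.{uX, v} μ} {N : NormedL0Module.{uX, w} μ}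

theorem ptDist_eq (a b : M) : M.ptDist a b = dist a b := by rw [dist_eq_norm]; rfl

instance : UniformContinuousConstSMul (L0 μ) M :=
  inferInstanceAs (UniformContinuousConstSMul (L0 μ) M.seminorm.Space)

instance : CompleteSpace M := by
  refine Metric.complete_of_cauchySeq_tendsto fun u hu => ?_
  obtain ⟨a, ha⟩ := M.complete u fun ε hε => by
    obtain ⟨N, hN⟩ := Metric.cauchySeq_iff.1 hu ε hε
    exact ⟨N, fun m hm n hn => (ptDist_eq _ _).trans_lt (hN m hm n hn)⟩
  exact ⟨a, tendsto_iff_dist_tendsto_zero.2 (ha.congr fun n => ptDist_eq _ _)⟩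

theorem continuous_ptNorm : Continuous M.ptNorm := M.seminorm.lipschitz_space.continuous

theorem generates_iff {S : Set M} : M.Generates S ↔ Dense (Submodule.span (L0 μ) S : Set M) := by
  simp only [Generates, ptDist_eq, Dense, Metric.mem_closure_iff]
  rfl

theorem Hom.norm_le (φ : Hom M N) (a : M) : ‖φ a‖ ≤ ‖a‖ :=
  L0.norm_mono (N.ptNorm_nonneg _) (φ.ptNorm_le a)

theorem Hom.continuous (φ : Hom M N) : Continuous φ :=
  AddMonoidHomClass.continuous_of_bound φ.toLinearMap 1 fun a => by
    rw [one_mul]; exact φ.norm_le a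

theorem Hom.ext {φ ψ : Hom M N} (h : ∀ a, φ a = ψ a) : φ = ψ := by
  cases φ; cases ψ
  congr
  exact LinearMap.ext h

theorem Hom.ext_of_dense {φ ψ : Hom M N} {S : Set M} (hS : Dense S) (h : ∀ a ∈ S, φ a = ψ a) :
    φ = ψ :=
  Hom.ext fun a => congrFun (φ.continuous.ext_on hS ψ.continuous h) a

theorem Hom.ext_of_generates {φ ψ : Hom M N} {S : Set M} (hS : M.Generates S)
    (h : ∀ a ∈ S, φ a = ψ a) : φ = ψ :=
  Hom.ext_of_dense (generates_iff.1 hS) fun _ ha => LinearMap.eqOn_span' (f := φ.toLinearMap)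
    (g := ψ.toLinearMap) h ha

/-- A linear map bounded by `|ι e|` extends along a map `ι` with dense range. -/
theorem exists_hom_of_dense {E : Type*} [AddCommGroup E] [Module (L0 μ) E] {ι : E →ₗ[L0 μ] M}
    (hι : DenseRange ι) (T : E →ₗ[L0 μ] N) (hT : ∀ e, N.ptNorm (T e) ≤ M.ptNorm (ι e)) :
    ∃ Φ : Hom M N, ∀ e, Φ (ι e) = T e := by
  -- The extension is the closure of the graph. The norm bound persists on `G` and makes it
  -- single-valued, completeness of `N` makes it total, and linearity is inherited from `G` being a
  -- submodule.
  let G : Submodule (L0 μ) (M × N) := (LinearMap.range (ι.prod T)).topologicalClosure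
  have hle : ∀ z ∈ G, N.ptNorm z.2 ≤ M.ptNorm z.1 := fun z hz => by
    have hc : IsClosed {z : M × N | N.ptNorm z.2 ≤ M.ptNorm z.1} :=
      isClosed_le (continuous_ptNorm.comp continuous_snd) (continuous_ptNorm.comp continuous_fst)
    refine closure_minimal ?_ hc hz
    rintro _ ⟨e, rfl⟩
    exact hT e
  have huniq : ∀ {m : M} {n n' : N}, (m, n) ∈ G → (m, n') ∈ G → n = n' := fun {m n n'} h h' => by
    have := hle _ (G.sub_mem h h')
    simp only [Prod.mk_sub_mk, sub_self] at this
    rw [(M.ptNorm_eq_zero_iff 0).2 rfl] at this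
    exact sub_eq_zero.1 ((N.ptNorm_eq_zero_iff _).1 (le_antisymm this (N.ptNorm_nonneg _)))
  have hex : ∀ m : M, ∃ n : N, (m, n) ∈ G := fun m => by
    obtain ⟨u, hu, hlim⟩ := mem_closure_iff_seq_limit.1 (hι m)
    choose e he using hu
    have hcau : CauchySeq fun n => T (e n) := by
      refine Metric.cauchySeq_iff.2 fun ε hε => ?_
      obtain ⟨K, hK⟩ := Metric.cauchySeq_iff.1 hlim.cauchySeq ε hε
      refine ⟨K, fun m hm n hn => lt_of_le_of_lt ?_ (hK m hm n hn)⟩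
      rw [dist_eq_norm, dist_eq_norm, ← he, ← he, ← _root_.map_sub, ← _root_.map_sub]
      exact L0.norm_mono (N.ptNorm_nonneg _) (hT _)
    obtain ⟨n, hn⟩ := cauchySeq_tendsto_of_complete hcau
    refine ⟨n, mem_closure_of_tendsto (hlim.prodMk_nhds hn) (Eventually.of_forall fun k => ?_)⟩
    exact ⟨e k, by simp [he]⟩
  choose Φ hΦ using hex
  refine ⟨⟨{ toFun := Φ, map_add' := fun a b => ?_, map_smul' := fun g a => ?_ }, fun a => ?_⟩,
    fun e => ?_⟩
  · exact huniq (hΦ _) (G.add_mem (hΦ a) (hΦ b))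
  · exact huniq (hΦ _) (G.smul_mem g (hΦ a))
  · exact hle _ (hΦ a)
  · exact huniq (hΦ _) (subset_closure ⟨e, rfl⟩)

/-- A point of the closure has errors of arbitrarily small norm, which force the essential infimum
to vanish. -/
theorem _root_.L0Seminorm.LocClosed.isClosed {K : Set M} (hK : M.seminorm.LocClosed K) :
    IsClosed K := by
  refine isClosed_of_closure_subset fun u hu => hK u fun h hh => ?_
  refine L0.le_of_forall_norm fun ε hε => ?_
  obtain ⟨a, ha, hd⟩ := Metric.mem_closure_iff.1 hu ε hε
  refine ⟨M.ptNorm (u - a), ?_, ?_⟩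
  · rwa [dist_eq_norm] at hd
  · rw [zero_add]; exact hh a ha

end

end NormedL0Module

/-! ### Completion of a seminormed module. -/

section Completion

open UniformSpace

variable {X : Type uX} [MeasurableSpace X] {μ : Measure X} [SFinite μ] {E : Type v}
  [AddCommGroup E] [Module (L0 μ) E] (p : L0Seminorm μ E)

namespace L0Seminorm

/-- The extension of a pointwise seminorm to the completion. -/
noncomputable def extension : Completion p.Space → L0 μ :=
  Completion.extension fun a : p.Space => p (show E from a)

theorem continuous_extension : Continuous p.extension := Completion.continuous_extension

theorem extension_coe (a : p.Space) : p.extension a = p (show E from a) :=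
  Completion.extension_coe p.lipschitz_space.uniformContinuous a

theorem norm_extension (a : Completion p.Space) : ‖p.extension a‖ = ‖a‖ := by
  induction a using Completion.induction_on with
  | hp => exact isClosed_eq p.continuous_extension.norm continuous_norm
  | ih a => rw [extension_coe, Completion.norm_coe, norm_space]

theorem _root_.L0.continuous_const_mul (g : L0 μ) : Continuous fun h : L0 μ => g * h := by
  refine continuous_of_continuousAt_zero (AddMonoidHom.mulLeft g) ?_
  rw [ContinuousAt, _root_.map_zero, tendsto_nhds_iff_seq_tendsto]
  exact fun u hu => L0.tendsto_mul_zero g hu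

theorem extension_nonneg (a : Completion p.Space) : 0 ≤ p.extension a := by
  induction a using Completion.induction_on with
  | hp => exact isClosed_le continuous_const p.continuous_extension
  | ih a => rw [extension_coe]; exact p.nonneg _

theorem extension_add_le (a b : Completion p.Space) :
    p.extension (a + b) ≤ p.extension a + p.extension b := by
  induction a, b using Completion.induction_on₂ with
  | hp =>
    have h := p.continuous_extension
    exact isClosed_le (by fun_prop) (by fun_prop)
  | ih a b =>
    rw [← Completion.coe_add, extension_coe, extension_coe, extension_coe]
    exact p.add_le _ _

theorem extension_smul (g : L0 μ) (a : Completion p.Space) :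
    p.extension (g • a) = |g| * p.extension a := by
  induction a using Completion.induction_on with
  | hp =>
    exact isClosed_eq (p.continuous_extension.comp (continuous_const_smul g))
      ((L0.continuous_const_mul _).comp p.continuous_extension)
  | ih a =>
    rw [← Completion.coe_smul, extension_coe, extension_coe]
    exact p.smul _ _

/-- The completion of a module with a pointwise seminorm. -/
noncomputable def completion : NormedL0Module.{uX, v} μ where
  carrier := Completion p.Space
  ptNorm := p.extension
  ptNorm_nonneg := p.extension_nonneg
  ptNorm_add_le := p.extension_add_le
  ptNorm_smul := p.extension_smul
  ptNorm_eq_zero_iff a := by rw [← norm_eq_zero, norm_extension, norm_eq_zero]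
  complete u hu := by
    have hd : ∀ a b : Completion p.Space, L0.size (p.extension (a - b)) = dist a b := fun a b => by
      rw [dist_eq_norm, ← norm_extension]; rfl
    simp_rw [hd] at hu ⊢
    obtain ⟨a, ha⟩ := cauchySeq_tendsto_of_complete (Metric.cauchySeq_iff.2 hu)
    exact ⟨a, tendsto_iff_dist_tendsto_zero.1 ha⟩

/-- The canonical map to the completion. -/
noncomputable def toCompletion : E →ₗ[L0 μ] p.completion where
  toFun a := ((show p.Space from a : p.Space) : Completion p.Space)
  map_add' a b := Completion.coe_add (show p.Space from a) (show p.Space from b)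
  map_smul' g a := Completion.coe_smul g (show p.Space from a)

theorem ptNorm_toCompletion (a : E) : p.completion.ptNorm (p.toCompletion a) = p a :=
  p.extension_coe a

theorem exists_dist_toCompletion_lt (a : p.completion) {ε : ℝ} (hε : 0 < ε) :
    ∃ e, p.completion.ptDist a (p.toCompletion e) < ε := by
  obtain ⟨e, he⟩ := (Completion.denseRange_coe (α := p.Space)).exists_dist_lt
    (show Completion p.Space from a) hε
  refine ⟨e, ?_⟩
  rw [dist_eq_norm, ← norm_extension] at he
  exact he

theorem denseRange_toCompletion : DenseRange p.toCompletion := fun a =>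
  Metric.mem_closure_iff.2 fun ε hε => by
    obtain ⟨e, he⟩ := p.exists_dist_toCompletion_lt a hε
    exact ⟨_, ⟨e, rfl⟩, by rwa [← NormedL0Module.ptDist_eq]⟩

end L0Seminorm

end Completion

/-! ### Direct limits: construction and characterisation. -/

namespace NormedL0Module

section DirectLimit

variable {X : Type uX} [MeasurableSpace X] {μ : Measure X} [SFinite μ] {I : Type w}
  [PartialOrder I] {M : I → NormedL0Module.{uX, v} μ} {φ : ∀ i j, i ≤ j → Hom (M i) (M j)}

/-- The pointwise norm of `φ' i a` is the essential infimum of the norms of `φ i j a`, `i ≤ j`. -/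
def NormIsInf (φ : ∀ i j, i ≤ j → Hom (M i) (M j)) (L : NormedL0Module.{uX, v} μ)
    (φ' : ∀ i, Hom (M i) L) : Prop :=
  ∀ i (a : M i) h, (∀ j (hij : i ≤ j), h ≤ (M j).ptNorm (φ i j hij a)) → h ≤ L.ptNorm (φ' i a)

theorem IsDirectSystem.directedSystem (hM : IsDirectSystem M φ) :
    DirectedSystem (fun i => M i) (fun i j h => ⇑(φ i j h).toLinearMap) where
  map_self i a := hM.map_self i a
  map_map _ _ _ hij hjk a := hM.map_map _ _ _ hij hjk a

theorem IsTarget.ptNorm_le {L : NormedL0Module.{uX, v} μ} {φ' : ∀ i, Hom (M i) L}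
    (hL : IsTarget M φ L φ') {i j : I} (hij : i ≤ j) (a : M i) :
    L.ptNorm (φ' i a) ≤ (M j).ptNorm (φ i j hij a) := by
  rw [← hL i j hij a]
  exact (φ' j).ptNorm_le _

variable [IsDirectedOrder I] [Nonempty I]

/-- Both targets receive maps from the algebraic direct limit. The one into `N` is dominated by the
one into `L`, because the norm in `L` is the largest any target allows. -/
theorem isDirectLimit_of_normIsInf {L : NormedL0Module.{uX, v} μ} {φ' : ∀ i, Hom (M i) L}
    (hL : IsTarget M φ L φ') (hinf : NormIsInf φ L φ')
    (hdense : Dense (⋃ i, Set.range (φ' i))) : IsDirectLimit M φ L φ' := by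
  classical
  refine ⟨hL, fun N ψ hψ => ?_⟩
  let ι := Module.DirectLimit.lift (L0 μ) I (fun i => M i) (fun i j h => (φ i j h).toLinearMap)
    (fun i => (φ' i).toLinearMap) hL
  let T := Module.DirectLimit.lift (L0 μ) I (fun i => M i) (fun i j h => (φ i j h).toLinearMap)
    (fun i => (ψ i).toLinearMap) hψ
  have hι : ∀ i (a : M i), ι (Module.DirectLimit.of _ _ _ _ i a) = φ' i a := fun i a =>
    Module.DirectLimit.lift_of ..
  have hT : ∀ i (a : M i), T (Module.DirectLimit.of _ _ _ _ i a) = ψ i a := fun i a =>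
    Module.DirectLimit.lift_of ..
  have hdι : DenseRange ι := by
    refine hdense.mono (Set.iUnion_subset fun i => ?_)
    rintro _ ⟨a, rfl⟩
    exact ⟨_, hι i a⟩
  obtain ⟨Φ, hΦ⟩ := exists_hom_of_dense hdι T fun e => by
    obtain ⟨i, a, rfl⟩ := Module.DirectLimit.exists_of e
    rw [hι, hT]
    exact hinf i a _ fun j hij => hψ.ptNorm_le hij a
  refine ⟨Φ, fun i a => by rw [← hι, hΦ, hT], fun Ψ hΨ => ?_⟩
  refine Hom.ext_of_dense hdense fun a ha => ?_
  obtain ⟨i, b, rfl⟩ := Set.mem_iUnion.1 ha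
  rw [hΨ, ← hι, hΦ, hT]

theorem exists_normIsInf (hM : IsDirectSystem M φ) :
    ∃ (L : NormedL0Module.{uX, max v w} μ) (φ' : ∀ i, M i →ₗ[L0 μ] L),
      (∀ i a, L.ptNorm (φ' i a) ≤ (M i).ptNorm a) ∧
      (∀ i j (hij : i ≤ j) (a : M i), φ' j (φ i j hij a) = φ' i a) ∧
      (∀ i (a : M i) h, (∀ j (hij : i ≤ j), h ≤ (M j).ptNorm (φ i j hij a)) →
        h ≤ L.ptNorm (φ' i a)) ∧
      Dense (⋃ i, Set.range (φ' i)) := by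
  classical
  have := hM.directedSystem
  let V := Module.DirectLimit (fun i => M i) (fun i j h => (φ i j h).toLinearMap)
  let o : ∀ i, M i →ₗ[L0 μ] V := fun i =>
    Module.DirectLimit.of (L0 μ) I (fun i => M i) (fun i j h => (φ i j h).toLinearMap) i
  -- The seminorm of `x` will be the essential infimum of the norms of all its representatives, at
  -- all indices.
  let R : V → Type _ := fun x => {a : Σ i, M i // o a.1 a.2 = x}
  have hR : ∀ x, Nonempty (R x) := fun x => by
    obtain ⟨i, a, ha⟩ := Module.DirectLimit.exists_of x
    exact ⟨⟨⟨i, a⟩, ha⟩⟩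
  let F : ∀ x, R x → L0 μ := fun x a => (M a.1.1).ptNorm a.1.2
  have hF : ∀ x (a : R x), 0 ≤ F x a := fun x a => (M a.1.1).ptNorm_nonneg _
  choose q hq using fun x => L0.exists_isGLB (hF x)
  have hqle : ∀ i (a : M i), q (o i a) ≤ (M i).ptNorm a := fun i a =>
    (hq (o i a)).1 ⟨⟨⟨i, a⟩, rfl⟩, rfl⟩
  have hoj : ∀ {i j} (hij : i ≤ j) (a : M i), o j (φ i j hij a) = o i a := fun hij a =>
    Module.DirectLimit.of_f
  have hle : ∀ x h, (∀ i (a : M i), o i a = x → h ≤ (M i).ptNorm a) → h ≤ q x := fun x h hh => by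
    refine (hq x).2 ?_
    rintro _ ⟨⟨⟨i, a⟩, ha⟩, rfl⟩
    exact hh i a ha
  let p : L0Seminorm μ V := L0Seminorm.ofSMulLE q
    (fun x => hle x 0 fun i a _ => (M i).ptNorm_nonneg a)
    (fun x y => by
      rw [← _root_.sub_le_iff_le_add]
      refine hle x _ fun i a ha => ?_
      rw [_root_.sub_le_iff_le_add, ← sub_le_iff_le_add']
      refine hle y _ fun j b hb => ?_
      rw [sub_le_iff_le_add']
      obtain ⟨k, hik, hjk⟩ := exists_ge_ge i j
      have : o k (φ i k hik a + φ j k hjk b) = x + y := by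
        rw [map_add, hoj, hoj, ha, hb]
      rw [← this]
      refine (hqle _ _).trans (((M k).ptNorm_add_le _ _).trans (add_le_add ?_ ?_))
      · exact (φ i k hik).ptNorm_le a
      · exact (φ j k hjk).ptNorm_le b)
    (fun g x => by
      refine L0.le_mul_of_isGLB (hF x) (abs_nonneg g) (hq x) ?_
      rintro ⟨⟨i, a⟩, ha⟩
      have := hqle i (g • a)
      rwa [map_smul, ha, (M i).ptNorm_smul] at this)
  refine ⟨p.completion, fun i => p.toCompletion ∘ₗ o i, fun i a => ?_, fun i j hij a => ?_,
    fun i a h hh => ?_, ?_⟩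
  · exact (p.ptNorm_toCompletion _).trans_le (hqle i a)
  · exact congrArg p.toCompletion (hoj hij a)
  · refine le_trans ?_ (p.ptNorm_toCompletion _).ge
    refine hle _ _ fun k b hb => ?_
    obtain ⟨j, hij, hkj⟩ := exists_ge_ge i k
    have h1 : o j (φ i j hij a) = o j (φ k j hkj b) := by rw [hoj, hoj, hb]
    -- Two representatives coincide from some index `l` on, where their common norm is at most that
    -- of `b`. Hence the images of `a` alone give the infimum over all representatives.
    obtain ⟨l, hjl, hl⟩ := Module.DirectLimit.exists_eq_of_of_eq h1
    have h2 := hh l (hij.trans hjl)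
    rw [← hM.map_map i j l hij hjl] at h2
    refine h2.trans (le_trans (le_of_eq (congrArg _ hl)) ?_)
    exact ((φ j l hjl).ptNorm_le _).trans ((φ k j hkj).ptNorm_le b)
  · refine p.denseRange_toCompletion.mono ?_
    rintro _ ⟨e, rfl⟩
    obtain ⟨i, a, rfl⟩ := Module.DirectLimit.exists_of e
    exact Set.mem_iUnion.2 ⟨i, a, rfl⟩

end DirectLimit

section DirectLimit

variable {X : Type uX} [MeasurableSpace X] {μ : Measure X} [SFinite μ] {I : Type w}
  [PartialOrder I] [IsDirectedOrder I] [Nonempty I] {M : I → NormedL0Module.{uX, max v w} μ}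
  {φ : ∀ i j, i ≤ j → Hom (M i) (M j)}

theorem exists_isDirectLimit_normIsInf (hM : IsDirectSystem M φ) :
    ∃ (L : NormedL0Module.{uX, max v w} μ) (φ' : ∀ i, Hom (M i) L),
      IsDirectLimit M φ L φ' ∧ NormIsInf φ L φ' ∧ Dense (⋃ i, Set.range (φ' i)) := by
  obtain ⟨L, φ', h1, h2, h3, h4⟩ := exists_normIsInf hM
  exact ⟨L, fun i => ⟨φ' i, h1 i⟩, isDirectLimit_of_normIsInf h2 h3 h4, h3, h4⟩

/-- Comparison with the concrete limit `L'`: `Φ` contracts norms, which carries the infimum formula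
back to `L`, and `Ψ ∘ Φ = id` by uniqueness, so density is carried over by `Ψ`. -/
theorem IsDirectLimit.normIsInf_and_dense (hM : IsDirectSystem M φ)
    {L : NormedL0Module.{uX, max v w} μ} {φ' : ∀ i, Hom (M i) L} (hL : IsDirectLimit M φ L φ') :
    NormIsInf φ L φ' ∧ Dense (⋃ i, Set.range (φ' i)) := by
  obtain ⟨L', χ, hL', hinf, hdense⟩ := exists_isDirectLimit_normIsInf hM
  obtain ⟨Φ, hΦ, -⟩ := hL.existsUnique L' χ hL'.isTarget
  obtain ⟨Ψ, hΨ, -⟩ := hL'.existsUnique L φ' hL.isTarget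
  refine ⟨fun i a h hh => ?_, fun l => ?_⟩
  · refine (hinf i a h hh).trans ?_
    rw [← hΦ]
    exact Φ.ptNorm_le _
  · let C : Hom L L := ⟨Ψ.toLinearMap ∘ₗ Φ.toLinearMap, fun a =>
      (Ψ.ptNorm_le _).trans (Φ.ptNorm_le a)⟩
    let D : Hom L L := ⟨LinearMap.id, fun a => le_rfl⟩
    have hCD : C = D := (hL.existsUnique L φ' hL.isTarget).unique
      (fun i a => (congrArg Ψ (hΦ i a)).trans (hΨ i a)) (fun i a => rfl)
    have hl : Ψ (Φ l) = l := congrArg (fun A : Hom L L => A l) hCD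
    rw [← hl]
    refine closure_mono ?_ (map_mem_closure Ψ.continuous (hdense (Φ l)) (Set.mapsTo_image _ _))
    rintro _ ⟨_, ha, rfl⟩
    obtain ⟨i, b, rfl⟩ := Set.mem_iUnion.1 ha
    exact Set.mem_iUnion.2 ⟨i, b, (hΨ i b).symm⟩

end DirectLimit

end NormedL0Module

/-! ### The normed module generated by a real vector space with an `L0`-valued seminorm. -/

namespace L0Seminorm

section Free

variable {X : Type*} [MeasurableSpace X] {μ : Measure X} {V : Type*} (q : V → L0 μ)
  (hq0 : ∀ a, 0 ≤ q a)

/-- The weighted `ℓ¹`-seminorm on the free module over a set. -/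
noncomputable def free : L0Seminorm μ (V →₀ L0 μ) where
  toFun u := u.sum fun a g => |g| * q a
  nonneg' u := Finset.sum_nonneg fun a _ => mul_nonneg (abs_nonneg _) (hq0 a)
  add_le' u u' := by
    classical
    rw [Finsupp.sum_of_support_subset (u + u') Finsupp.support_add _ (by simp),
      Finsupp.sum_of_support_subset u Finset.subset_union_left _ (by simp),
      Finsupp.sum_of_support_subset u' Finset.subset_union_right _ (by simp),
      ← Finset.sum_add_distrib]
    refine Finset.sum_le_sum fun a _ => ?_
    rw [← add_mul]
    exact mul_le_mul_of_nonneg_right (abs_add_le _ _) (hq0 a)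
  smul' g u := by
    rw [Finsupp.sum_of_support_subset (g • u) Finsupp.support_smul _ (by simp), Finsupp.sum,
      Finset.mul_sum]
    refine Finset.sum_congr rfl fun a _ => ?_
    rw [Finsupp.smul_apply, smul_eq_mul, L0.abs_mul', mul_assoc]

/-- The inclusion of real linear combinations into `L0 μ`-linear combinations. -/
noncomputable def constFinsupp (μ : Measure X) : (V →₀ ℝ) →+ (V →₀ L0 μ) :=
  Finsupp.mapRange.addMonoidHom (L0.constHom μ).toAddMonoidHom

theorem constFinsupp_single (a : V) (r : ℝ) :
    constFinsupp μ (Finsupp.single a r) = Finsupp.single a (L0.constHom μ r) :=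
  Finsupp.mapRange_single (hf := (L0.constHom μ).map_zero)

theorem constFinsupp_smul (r : ℝ) (c : V →₀ ℝ) :
    constFinsupp μ (r • c) = L0.constHom μ r • constFinsupp μ c := by
  ext1 a
  exact (L0.constHom μ).map_mul r (c a)

theorem span_range_single_one :
    Submodule.span (L0 μ) (Set.range fun a : V => Finsupp.single a (1 : L0 μ)) = ⊤ := by
  rw [eq_top_iff]
  rintro u -
  induction u using Finsupp.induction_linear with
  | zero => exact zero_mem _
  | add u u' hu hu' => exact add_mem hu hu'
  | single a g =>
    rw [← mul_one g, ← smul_eq_mul, ← Finsupp.smul_single]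
    exact Submodule.smul_mem _ _ (Submodule.subset_span ⟨a, rfl⟩)

end Free

section Generated

variable {X : Type uX} [MeasurableSpace X] {μ : Measure X} {V : Type v} [AddCommGroup V]
  [Module ℝ V] {q : V → L0 μ}

theorem le_free (hq0 : ∀ a, 0 ≤ q a) (hqadd : ∀ a b, q (a + b) ≤ q a + q b)
    (hqsmul : ∀ (r : ℝ) a, q (r • a) = L0.constHom μ |r| * q a) (c : V →₀ ℝ) :
    q (Finsupp.linearCombination ℝ id c) ≤ free q hq0 (constFinsupp μ c) := by
  classical
  have hz : q 0 = 0 := by simpa using hqsmul 0 0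
  have e : free q hq0 (constFinsupp μ c) = ∑ a ∈ c.support, |L0.constHom μ (c a)| * q a :=
    Finsupp.sum_mapRange_index (hf := (L0.constHom μ).map_zero) (h := fun a g => |g| * q a)
      (by simp)
  rw [e, Finsupp.linearCombination_apply, Finsupp.sum]
  refine (Finset.le_sum_of_subadditive q hz.le hqadd _ _).trans (Finset.sum_le_sum fun a _ => ?_)
  rw [hqsmul, L0.abs_constHom]
  rfl

variable [SFinite μ]

/-- A real vector space with a seminorm valued in `L0 μ` generates a seminormed `L0 μ`-module. -/
theorem exists_seminorm_free (hq0 : ∀ a, 0 ≤ q a) (hqadd : ∀ a b, q (a + b) ≤ q a + q b)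
    (hqsmul : ∀ (r : ℝ) a, q (r • a) = L0.constHom μ |r| * q a) :
    ∃ p : L0Seminorm μ (V →₀ L0 μ), ∀ c : V →₀ ℝ,
      p (constFinsupp μ c) = q (Finsupp.linearCombination ℝ id c) := by
  let T : (V →₀ ℝ) → V := Finsupp.linearCombination ℝ id
  have hT : ∀ c d, T (c + d) = T c + T d := fun c d => map_add _ c d
  have hTs : ∀ (r : ℝ) c, T (r • c) = r • T c := fun r c => map_smul _ r c
  let C : (V →₀ ℝ) → (V →₀ L0 μ) := constFinsupp μ
  have hC : ∀ c d, C (c + d) = C c + C d := fun c d => map_add _ c d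
  have hCsub : ∀ c d, C (c - d) = C c - C d := fun c d => map_sub _ c d
  let l := free q hq0
  -- Infimal convolution: a real combination `c` is measured by `q`, the remainder by the weighted
  -- `ℓ¹`-seminorm. The `ℓ¹`-seminorm dominates `q` on real combinations, so the infimum does not
  -- drop below `q` there.
  let F : (V →₀ L0 μ) → (V →₀ ℝ) → L0 μ := fun u c => q (T c) + l (u - C c)
  have hF : ∀ u c, 0 ≤ F u c := fun u c => add_nonneg (hq0 _) (l.nonneg _)
  choose p hp using fun u => L0.exists_isGLB (hF u)
  have hle : ∀ u c, p u ≤ q (T c) + l (u - C c) := fun u c => (hp u).1 ⟨c, rfl⟩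
  have hge : ∀ u h, (∀ c, h ≤ q (T c) + l (u - C c)) → h ≤ p u := fun u h hh => by
    refine (hp u).2 ?_
    rintro _ ⟨c, rfl⟩
    exact hh c
  refine ⟨ofSMulLE p (fun u => hge u 0 (hF u)) (fun u u' => ?_) (fun g u => ?_), fun c => ?_⟩
  · rw [← _root_.sub_le_iff_le_add]
    refine hge u _ fun c => ?_
    rw [_root_.sub_le_iff_le_add, ← sub_le_iff_le_add']
    refine hge u' _ fun d => ?_
    rw [sub_le_iff_le_add']
    refine (hle (u + u') (c + d)).trans ?_
    rw [hT, hC, add_sub_add_comm]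
    calc _ ≤ (q (T c) + q (T d)) + (l (u - C c) + l (u' - C d)) :=
          add_le_add (hqadd _ _) (l.add_le _ _)
      _ = _ := add_add_add_comm _ _ _ _
  · refine L0.le_mul_of_isGLB (hF u) (abs_nonneg g) (hp u) fun c => ?_
    -- For `g • u` the competitor must be real, so `r • c` replaces `g • c`. Every resulting error
    -- is a multiple of `|g - r|`.
    refine L0.le_of_forall_const (g := g) (t := q (T c) + l (C c)) fun r => ?_
    refine (hle _ (r • c)).trans ?_
    have e : g • u - C (r • c) = g • (u - C c) + (g - L0.constHom μ r) • C c := by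
      rw [show C (r • c) = L0.constHom μ r • C c from constFinsupp_smul r c, smul_sub, sub_smul]
      abel
    have h1 : L0.constHom μ |r| ≤ |g| + |g - L0.constHom μ r| := by
      rw [← L0.abs_constHom]
      calc |L0.constHom μ r| = |g + -(g - L0.constHom μ r)| := by congr 1; abel
        _ ≤ |g| + |-(g - L0.constHom μ r)| := abs_add_le _ _
        _ = _ := by rw [abs_neg]
    rw [hTs, hqsmul, e]
    calc _ ≤ (|g| + |g - L0.constHom μ r|) * q (T c)
          + (|g| * l (u - C c) + |g - L0.constHom μ r| * l (C c)) := by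
          refine add_le_add (mul_le_mul_of_nonneg_right h1 (hq0 _)) ?_
          rw [← l.smul, ← l.smul]
          exact l.add_le _ _
      _ = |g| * (q (T c) + l (u - C c))
          + |g - L0.constHom μ r| * (q (T c) + l (C c)) := by ring
  · refine le_antisymm ?_ (hge _ _ fun d => ?_)
    · refine (hle _ c).trans_eq ?_
      rw [show constFinsupp μ c - C c = 0 from sub_self _, l.map_zero, add_zero]
    · have e : T c = T d + T (c - d) := by rw [← hT]; congr 1; abel
      change q (T c) ≤ _
      rw [e]
      refine (hqadd _ _).trans ?_
      gcongr
      change _ ≤ l (C c - C d)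
      rw [← hCsub]
      exact le_free hq0 hqadd hqsmul (c - d)

/-- The normed module generated by a real vector space with a seminorm valued in `L0 μ`. -/
theorem exists_normedL0Module (hq0 : ∀ a, 0 ≤ q a) (hqadd : ∀ a b, q (a + b) ≤ q a + q b)
    (hqsmul : ∀ (r : ℝ) a, q (r • a) = L0.constHom μ |r| * q a) :
    ∃ (N : NormedL0Module.{uX, max uX v} μ) (j : V → N),
      (∀ a b, j (a + b) = j a + j b) ∧ (∀ (r : ℝ) a, j (r • a) = L0.constHom μ r • j a) ∧
      (∀ a, N.ptNorm (j a) = q a) ∧ N.Generates (Set.range j) := by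
  obtain ⟨p, hp⟩ := exists_seminorm_free hq0 hqadd hqsmul
  have hz : q 0 = 0 := by simpa using hqsmul 0 0
  let J : (V →₀ ℝ) →+ p.completion := p.toCompletion.toAddMonoidHom.comp (constFinsupp μ)
  have hJ : ∀ c, p.completion.ptNorm (J c) = q (Finsupp.linearCombination ℝ id c) := fun c =>
    (p.ptNorm_toCompletion _).trans (hp c)
  -- Combinations with the same value in `V` have the same image, since their difference has norm `q
  -- 0 = 0`. Additivity and homogeneity of `j` follow.
  have hJ0 : ∀ c d, Finsupp.linearCombination ℝ id c = Finsupp.linearCombination ℝ (id : V → V) d →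
      J c = J d := fun c d h => by
    rw [← sub_eq_zero, ← map_sub, ← p.completion.ptNorm_eq_zero_iff, hJ, map_sub, h, sub_self, hz]
  refine ⟨p.completion, fun a => J (Finsupp.single a 1), fun a b => ?_, fun r a => ?_,
    fun a => ?_, ?_⟩
  · rw [← map_add]
    exact hJ0 _ _ (by simp)
  · have : L0.constHom μ r • J (Finsupp.single a 1) = J (r • Finsupp.single a 1) := by
      refine (p.toCompletion.map_smul _ _).symm.trans ?_
      exact congrArg p.toCompletion (constFinsupp_smul _ _).symm
    rw [this]
    exact hJ0 _ _ (by simp)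
  · rw [hJ]; simp
  · rw [NormedL0Module.generates_iff]
    refine p.denseRange_toCompletion.mono ?_
    rintro _ ⟨u, rfl⟩
    have hu : u ∈ Submodule.span (L0 μ) (Set.range fun a : V => Finsupp.single a (1 : L0 μ)) := by
      rw [span_range_single_one]; trivial
    have := Submodule.mem_map_of_mem (f := p.toCompletion) hu
    rw [Submodule.map_span, ← Set.range_comp] at this
    refine Submodule.span_mono ?_ this
    rintro _ ⟨a, rfl⟩
    refine ⟨a, congrArg p.toCompletion ?_⟩
    rw [constFinsupp_single, map_one]

end Generated

end L0Seminorm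

/-! ### Existence and functoriality of pullbacks. -/

theorem L0.comp_mono {X Y : Type*} [MeasurableSpace X] [MeasurableSpace Y] {μ : Measure X}
    {ν : Measure Y} {f : X → Y} (hf : QuasiMeasurePreserving f μ ν) {a b : L0 ν} (h : a ≤ b) :
    a.compQuasiMeasurePreserving f hf ≤ b.compQuasiMeasurePreserving f hf := by
  rw [L0.le_iff] at *
  filter_upwards [hf.ae h, AEEqFun.coeFn_compQuasiMeasurePreserving a hf,
    AEEqFun.coeFn_compQuasiMeasurePreserving b hf] with x h1 h2 h3
  rwa [h2, h3]

theorem L0.comp_add {X Y : Type*} [MeasurableSpace X] [MeasurableSpace Y] {μ : Measure X}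
    {ν : Measure Y} {f : X → Y} (hf : QuasiMeasurePreserving f μ ν) (a b : L0 ν) :
    (a + b).compQuasiMeasurePreserving f hf
      = a.compQuasiMeasurePreserving f hf + b.compQuasiMeasurePreserving f hf :=
  AEEqFun.induction_on₂ a b fun _ _ _ _ => rfl

theorem L0.comp_mul {X Y : Type*} [MeasurableSpace X] [MeasurableSpace Y] {μ : Measure X}
    {ν : Measure Y} {f : X → Y} (hf : QuasiMeasurePreserving f μ ν) (a b : L0 ν) :
    (a * b).compQuasiMeasurePreserving f hf
      = a.compQuasiMeasurePreserving f hf * b.compQuasiMeasurePreserving f hf :=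
  AEEqFun.induction_on₂ a b fun _ _ _ _ => rfl

namespace NormedL0Module

section Pullback

variable {X : Type uX} {Y : Type uY} [MeasurableSpace X] [MeasurableSpace Y]
  {μ : Measure X} {ν : Measure Y} [SFinite μ] [SFinite ν] {f : X → Y}
  (hf : QuasiMeasurePreserving f μ ν)

theorem nonempty_pullback (M : NormedL0Module.{uY, v} ν) :
    Nonempty (Pullback.{uX, uY, v, max uX v} hf M) := by
  -- The elements of `M` with seminorm `|a| ∘ f` form only a real seminormed space over `μ`; the `L0
  -- μ`-module is generated from it.
  let _ : Module ℝ M := Module.compHom M (L0.constHom ν)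
  have hs : ∀ (r : ℝ) (a : M), r • a = L0.constHom ν r • a := fun _ _ => rfl
  obtain ⟨N, j, h1, h2, h3, h4⟩ := L0Seminorm.exists_normedL0Module (μ := μ)
    (q := fun a : M => (M.ptNorm a).compQuasiMeasurePreserving f hf)
    (fun a => L0.comp_mono hf (M.ptNorm_nonneg a))
    (fun a b => (L0.comp_mono hf (M.ptNorm_add_le a b)).trans_eq (L0.comp_add hf _ _))
    (fun r a => by
      rw [hs, M.ptNorm_smul, L0.abs_constHom, L0.comp_mul]
      rfl)
  exact ⟨⟨N, j, h1, h2, h3, h4⟩⟩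

variable {hf} {M N : NormedL0Module.{uY, v} ν}

theorem Pullback.map_zero (P : Pullback.{uX, uY, v, w} hf M) : P.map 0 = 0 := by
  have := P.map_add 0 0
  rwa [add_zero, left_eq_add] at this

theorem Pullback.map_sub (P : Pullback.{uX, uY, v, w} hf M) (a b : M) :
    P.map (a - b) = P.map a - P.map b := by
  rw [eq_sub_iff_add_eq, ← P.map_add, sub_add_cancel]

theorem Pullback.constHom_smul_map (P : Pullback.{uX, uY, v, w} hf M) (r : ℝ) (a : M) :
    L0.constHom μ r • P.map a = P.map (L0.constHom ν r • a) := (P.map_smul r a).symm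

/-- Composition with `f` preserves convergence to zero of the pointwise norms, by the subsequence
argument. -/
theorem Pullback.continuous_map (P : Pullback.{uX, uY, v, w} hf M) : Continuous P.map := by
  refine continuous_iff_seqContinuous.2 fun u a hu => ?_
  rw [← tendsto_sub_nhds_zero_iff, tendsto_zero_iff_norm_tendsto_zero] at hu ⊢
  have h := L0.tendsto_comp_zero hf (h := fun n => M.ptNorm (u n - a))
    (tendsto_zero_iff_norm_tendsto_zero.2 hu)
  refine (tendsto_zero_iff_norm_tendsto_zero.1 h).congr fun n => ?_
  rw [← P.ptNorm_map, P.map_sub]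
  rfl

theorem exists_isPullbackHom (P : Pullback.{uX, uY, v, w} hf M) (Q : Pullback.{uX, uY, v, w} hf N)
    (φ : Hom M N) : ∃ ψ, IsPullbackHom P Q φ ψ := by
  let ι := Finsupp.linearCombination (L0 μ) P.map
  let T := Finsupp.linearCombination (L0 μ) fun a => Q.map (φ a)
  have hι : ∀ a, ι (Finsupp.single a 1) = P.map a := fun a => by simp [ι]
  have hT : ∀ a, T (Finsupp.single a 1) = Q.map (φ a) := fun a => by simp [T]
  -- The sum controls both sides of the desired inequality `|T e| ≤ |ι e|` when `e` is perturbed.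
  let p := (P.obj.seminorm.comp ι).add (Q.obj.seminorm.comp T)
  let K : Set (M →₀ L0 μ) := {e | Q.obj.ptNorm (T e) ≤ P.obj.ptNorm (ι e)}
  -- Formal combinations that both maps evaluate as one element `a`. There the inequality is that of
  -- `φ` composed with `f`, and `S` is stable under sums and real multiples, as locality requires.
  let S : Set (M →₀ L0 μ) := {e | ∃ a, ι e = P.map a ∧ T e = Q.map (φ a)}
  have hK : p.LocClosed K := fun u hu => by
    refine sub_nonpos.1 (hu _ fun a ha => ?_)
    rw [sub_le_iff_le_add']
    calc Q.obj.ptNorm (T u) ≤ Q.obj.ptNorm (T a) + Q.obj.ptNorm (T (u - a)) := by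
          rw [_root_.map_sub]; exact Q.obj.seminorm.le_add_sub _ _
      _ ≤ (P.obj.ptNorm (ι u) + P.obj.ptNorm (ι (u - a))) + Q.obj.ptNorm (T (u - a)) := by
          gcongr
          refine le_trans ha ?_
          rw [_root_.map_sub]
          exact P.obj.seminorm.le_add_sub' _ _
      _ = _ := add_assoc _ _ _
  have hspan := hK.span_subset (S := S)
    (by
      rintro e ⟨a, h1, h2⟩
      change Q.obj.ptNorm (T e) ≤ P.obj.ptNorm (ι e)
      rw [h1, h2, P.ptNorm_map, Q.ptNorm_map]
      exact L0.comp_mono hf (φ.ptNorm_le a))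
    ⟨0, by rw [P.map_zero, _root_.map_zero],
      by rw [_root_.map_zero, _root_.map_zero, Q.map_zero]⟩
    (by
      rintro e ⟨a, h1, h2⟩ e' ⟨a', h1', h2'⟩
      exact ⟨a + a', by rw [_root_.map_add, h1, h1', P.map_add],
        by rw [_root_.map_add, h2, h2', _root_.map_add, Q.map_add]⟩)
    (by
      rintro r e ⟨a, h1, h2⟩
      exact ⟨L0.constHom ν r • a, by rw [_root_.map_smul, h1, P.constHom_smul_map],
        by rw [_root_.map_smul, h2, _root_.map_smul, Q.constHom_smul_map]⟩)
  have hall : ∀ e, Q.obj.ptNorm (T e) ≤ P.obj.ptNorm (ι e) := fun e => hspan <| by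
    refine Submodule.span_mono ?_ (show e ∈ Submodule.span (L0 μ)
      (Set.range fun a : M => Finsupp.single a (1 : L0 μ)) from ?_)
    · rintro _ ⟨a, rfl⟩
      exact ⟨a, hι a, hT a⟩
    · rw [L0Seminorm.span_range_single_one]; trivial
  have hdense : DenseRange ι := by
    have h := generates_iff.1 P.generates
    rw [← Finsupp.range_linearCombination] at h
    exact h
  obtain ⟨ψ, hψ⟩ := exists_hom_of_dense hdense T hall
  exact ⟨ψ, fun a => by rw [← hι, hψ, hT]⟩

theorem existsUnique_isPullbackHom (P : Pullback.{uX, uY, v, w} hf M)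
    (Q : Pullback.{uX, uY, v, w} hf N) (φ : Hom M N) : ∃! ψ, IsPullbackHom P Q φ ψ := by
  obtain ⟨ψ, hψ⟩ := exists_isPullbackHom P Q φ
  refine ⟨ψ, hψ, fun χ hχ => Hom.ext_of_generates P.generates ?_⟩
  rintro _ ⟨a, rfl⟩
  rw [hχ, hψ]

end Pullback

end NormedL0Module

/-! ### Pullback of direct systems and of their limits. -/

namespace NormedL0Module

section PullbackLimit

variable {X : Type uX} {Y : Type uY} [MeasurableSpace X] [MeasurableSpace Y]
  {μ : Measure X} {ν : Measure Y} [SFinite μ] [SFinite ν] {f : X → Y}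
  {hf : QuasiMeasurePreserving f μ ν} {I : Type*} [PartialOrder I]
  {M : I → NormedL0Module.{uY, v} ν} {φ : ∀ i j, i ≤ j → Hom (M i) (M j)}
  {L : NormedL0Module.{uY, v} ν} {φ' : ∀ i, Hom (M i) L}
  {P : ∀ i, Pullback.{uX, uY, v, w} hf (M i)} {Q : Pullback.{uX, uY, v, w} hf L}
  {fφ : ∀ i j, i ≤ j → Hom (P i).obj (P j).obj} {fφ' : ∀ i, Hom (P i).obj Q.obj}

theorem IsDirectSystem.pullback (hM : IsDirectSystem M φ)
    (hfφ : ∀ i j (h : i ≤ j), IsPullbackHom (P i) (P j) (φ i j h) (fφ i j h)) :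
    IsDirectSystem (fun i => (P i).obj) fφ where
  map_self i a := by
    let D : Hom (P i).obj (P i).obj := ⟨LinearMap.id, fun a => le_rfl⟩
    have h : fφ i i le_rfl = D := Hom.ext_of_generates (P i).generates <| by
      rintro _ ⟨a, rfl⟩
      rw [hfφ, hM.map_self]
      rfl
    exact congrArg (fun A : Hom (P i).obj (P i).obj => A a) h
  map_map i j k hij hjk a := by
    let D : Hom (P i).obj (P k).obj := ⟨(fφ j k hjk).toLinearMap ∘ₗ (fφ i j hij).toLinearMap,
      fun a => ((fφ j k hjk).ptNorm_le _).trans ((fφ i j hij).ptNorm_le a)⟩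
    have h : D = fφ i k (hij.trans hjk) := Hom.ext_of_generates (P i).generates <| by
      rintro _ ⟨a, rfl⟩
      change fφ j k hjk (fφ i j hij ((P i).map a)) = _
      rw [hfφ, hfφ, hfφ, hM.map_map]
    exact congrArg (fun A : Hom (P i).obj (P k).obj => A a) h

theorem IsTarget.pullback (hL : IsTarget M φ L φ')
    (hfφ : ∀ i j (h : i ≤ j), IsPullbackHom (P i) (P j) (φ i j h) (fφ i j h))
    (hfφ' : ∀ i, IsPullbackHom (P i) Q (φ' i) (fφ' i)) :
    IsTarget (fun i => (P i).obj) fφ Q.obj fφ' := fun i j hij a => by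
  let D : Hom (P i).obj Q.obj := ⟨(fφ' j).toLinearMap ∘ₗ (fφ i j hij).toLinearMap,
    fun a => ((fφ' j).ptNorm_le _).trans ((fφ i j hij).ptNorm_le a)⟩
  have h : D = fφ' i := Hom.ext_of_generates (P i).generates <| by
    rintro _ ⟨a, rfl⟩
    change fφ' j (fφ i j hij ((P i).map a)) = _
    rw [hfφ, hfφ', hfφ', hL]
  exact congrArg (fun A : Hom (P i).obj Q.obj => A a) h

/-- On elements `f^* a` the formula is the one for `a`, composed with `f`. The set `K` where it
holds is local, so it contains their `L0`-span and then the closure of that span. -/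
theorem NormIsInf.pullback (hL : IsTarget M φ L φ') (hinf : NormIsInf φ L φ')
    (hfφ : ∀ i j (h : i ≤ j), IsPullbackHom (P i) (P j) (φ i j h) (fφ i j h))
    (hfφ' : ∀ i, IsPullbackHom (P i) Q (φ' i) (fφ' i)) :
    NormIsInf fφ Q.obj fφ' := fun i => by
  let s := (P i).obj.seminorm
  let K : Set (P i).obj := {u | ∀ h, (∀ j (hij : i ≤ j), h ≤ (P j).obj.ptNorm (fφ i j hij u)) →
    h ≤ Q.obj.ptNorm (fφ' i u)}
  -- Replacing `u` by `a` costs `s (u - a)` on each side, hence the doubled error.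
  have hK : s.LocClosed K := s.locClosed_of_add_self fun u hu h hh => by
    refine sub_nonpos.1 (hu _ fun a ha => ?_)
    have h1 : h - s (u - a) ≤ Q.obj.ptNorm (fφ' i a) := ha _ fun j hij => by
      rw [_root_.sub_le_iff_le_add]
      refine (hh j hij).trans (((P j).obj.seminorm.le_add_sub _ (fφ i j hij a)).trans ?_)
      rw [← _root_.map_sub]
      exact add_le_add le_rfl ((fφ i j hij).ptNorm_le _)
    have h2 : Q.obj.ptNorm (fφ' i a) ≤ Q.obj.ptNorm (fφ' i u) + s (u - a) := by
      refine (Q.obj.seminorm.le_add_sub' _ (fφ' i u)).trans ?_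
      rw [← _root_.map_sub]
      exact add_le_add le_rfl ((fφ' i).ptNorm_le _)
    rw [sub_le_iff_le_add', ← add_assoc, ← _root_.sub_le_iff_le_add]
    exact h1.trans h2
  have hrange : Set.range (P i).map ⊆ K := by
    rintro _ ⟨a, rfl⟩ h hh
    rw [hfφ', Q.ptNorm_map]
    let F : {j // i ≤ j} → L0 ν := fun j => (M j.1).ptNorm (φ i j.1 j.2 a)
    have hne : Nonempty {j // i ≤ j} := ⟨⟨i, le_rfl⟩⟩
    have hglb : IsGLB (Set.range F) (L.ptNorm (φ' i a)) := by
      refine ⟨?_, fun h hh => hinf i a h fun j hij => hh ⟨⟨j, hij⟩, rfl⟩⟩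
      rintro _ ⟨j, rfl⟩
      exact hL.ptNorm_le j.2 a
    refine L0.le_comp_of_isGLB hf (F := F) (fun j => (M j.1).ptNorm_nonneg _) hglb fun j => ?_
    have := hh j.1 j.2
    rwa [hfφ, (P j.1).ptNorm_map] at this
  have hspan := hK.span_subset hrange ⟨0, (P i).map_zero⟩
    (by
      rintro _ ⟨a, rfl⟩ _ ⟨b, rfl⟩
      exact ⟨a + b, (P i).map_add a b⟩)
    (by
      rintro r _ ⟨a, rfl⟩
      exact ⟨_, ((P i).constHom_smul_map r a).symm⟩)
  exact fun a => closure_minimal hspan (L0Seminorm.LocClosed.isClosed hK)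
    (generates_iff.1 (P i).generates a)

/-- By directedness the union of ranges is a submodule, so its closure contains the span of `f^* L`
as soon as it contains each `f^* l`. The latter follows from density in `L` and continuity of `f^*`.
-/
theorem dense_iUnion_range_pullback [IsDirectedOrder I] [Nonempty I]
    (hL : IsTarget (fun i => (P i).obj) fφ Q.obj fφ') (hdense : Dense (⋃ i, Set.range (φ' i)))
    (hfφ' : ∀ i, IsPullbackHom (P i) Q (φ' i) (fφ' i)) :
    Dense (⋃ i, Set.range (fφ' i)) := by
  let R : I → Submodule (L0 μ) Q.obj := fun i => LinearMap.range (fφ' i).toLinearMap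
  have hR : Directed (· ≤ ·) R := directed_of_isDirected_le fun i j hij => by
    rintro _ ⟨a, rfl⟩
    exact ⟨fφ i j hij a, hL i j hij a⟩
  have hW : ((⨆ i, R i : Submodule (L0 μ) Q.obj) : Set Q.obj) = ⋃ i, Set.range (fφ' i) :=
    Submodule.coe_iSup_of_directed R hR
  have hspan : Submodule.span (L0 μ) (Set.range Q.map) ≤ (⨆ i, R i).topologicalClosure := by
    refine Submodule.span_le.2 ?_
    rintro _ ⟨l, rfl⟩
    refine closure_mono ?_ (map_mem_closure Q.continuous_map (hdense l) (Set.mapsTo_image _ _))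
    refine subset_trans ?_ hW.ge
    rintro _ ⟨_, ha, rfl⟩
    obtain ⟨i, a, rfl⟩ := Set.mem_iUnion.1 ha
    exact Set.mem_iUnion.2 ⟨i, (P i).map a, hfφ' i a⟩
  rw [← hW]
  exact fun q => closure_minimal hspan isClosed_closure (generates_iff.1 Q.generates q)

end PullbackLimit

end NormedL0Module

/-! ### The theorem. -/

theorem mainTheorem3
    {X : Type uX} [MetricSpace X] [CompleteSpace X] [SecondCountableTopology X]
    [MeasurableSpace X] [BorelSpace X] (mX : Measure X) [IsLocallyFiniteMeasure mX]
    {Y : Type uY} [MetricSpace Y] [CompleteSpace Y] [SecondCountableTopology Y]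
    [MeasurableSpace Y] [BorelSpace Y] (mY : Measure Y) [IsLocallyFiniteMeasure mY]
    (f : X → Y) (hf : Measurable f) (hac : mX.map f ≪ mY)
    {I : Type w} [PartialOrder I] [IsDirectedOrder I] [Nonempty I]
    (M : I → NormedL0Module.{uY, max v w} mY)
    (φ : ∀ i j, i ≤ j → NormedL0Module.Hom (M i) (M j))
    (hM : NormedL0Module.IsDirectSystem M φ) :
    -- the direct limit of the given system exists
    (∃ (L : NormedL0Module.{uY, max v w} mY) (φ' : ∀ i, NormedL0Module.Hom (M i) L),
      NormedL0Module.IsDirectLimit M φ L φ') ∧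
    -- pullbacks of modules exist
    (∀ N : NormedL0Module.{uY, max v w} mY,
      Nonempty (NormedL0Module.Pullback.{uX, uY, max v w, max uX v w} (μ := mX) ⟨hf, hac⟩ N)) ∧
    -- whatever realizations of the direct limit and of the pullbacks are chosen
    (∀ (L : NormedL0Module.{uY, max v w} mY) (φ' : ∀ i, NormedL0Module.Hom (M i) L),
      NormedL0Module.IsDirectLimit M φ L φ' →
      ∀ (P : ∀ i, NormedL0Module.Pullback.{uX, uY, max v w, max uX v w} (μ := mX) ⟨hf, hac⟩ (M i))
        (Q : NormedL0Module.Pullback.{uX, uY, max v w, max uX v w} (μ := mX) ⟨hf, hac⟩ L),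
      -- the pullback morphisms exist and are unique
      (∀ i j (h : i ≤ j), ∃! ψ, NormedL0Module.IsPullbackHom (P i) (P j) (φ i j h) ψ) ∧
      (∀ i, ∃! ψ, NormedL0Module.IsPullbackHom (P i) Q (φ' i) ψ) ∧
      -- the pulled back system is a direct system, and its direct limit is the pulled back limit
      ∀ (fφ : ∀ i j, i ≤ j → NormedL0Module.Hom (P i).obj (P j).obj)
        (fφ' : ∀ i, NormedL0Module.Hom (P i).obj Q.obj),
        (∀ i j (h : i ≤ j), NormedL0Module.IsPullbackHom (P i) (P j) (φ i j h) (fφ i j h)) →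
        (∀ i, NormedL0Module.IsPullbackHom (P i) Q (φ' i) (fφ' i)) →
        NormedL0Module.IsDirectSystem (fun i => (P i).obj) fφ ∧
        NormedL0Module.IsDirectLimit (fun i => (P i).obj) fφ Q.obj fφ') := by
  refine ⟨?_, fun N => NormedL0Module.nonempty_pullback.{uX, uY, max v w} _ N, ?_⟩
  · obtain ⟨L, φ', h, -⟩ := NormedL0Module.exists_isDirectLimit_normIsInf.{uY, v, w} hM
    exact ⟨L, φ', h⟩
  · intro L φ' hL P Q
    refine ⟨fun i j h => NormedL0Module.existsUnique_isPullbackHom _ _ _,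
      fun i => NormedL0Module.existsUnique_isPullbackHom _ _ _, fun fφ fφ' hfφ hfφ' => ?_⟩
    obtain ⟨hinf, hdense⟩ := NormedL0Module.IsDirectLimit.normIsInf_and_dense.{uY, v, w} hM hL
    have ht := hL.isTarget.pullback hfφ hfφ'
    exact ⟨hM.pullback hfφ, NormedL0Module.isDirectLimit_of_normIsInf ht
      (hinf.pullback hL.isTarget hfφ hfφ')
      (NormedL0Module.dense_iUnion_range_pullback ht hdense hfφ')⟩
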